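/- Let $\mathbb Q\in\{\mathbb H,\mathbb T\}$ (hyperbolic or trigonometric), let $\alpha>0$ be real and $p\ge 2$ an integer. For each integer $n\ge 2$ put $\mu=\mu(n)=n\alpha$ (non-nested case) or $\mu=\mu(n)=\alpha$ (nested case). Call $n\ge2$ admissible if $\mathbb Q=\mathbb H$, or if $\mathbb Q=\mathbb T$ and $\mu(n)<n\pi$. Consider the knots $t_1=\dots=t_{p+1}=0$, $t_{p+1+i}=i/n$ $(0\le i\le n)$, $t_{p+n+1}=\dots=t_{2p+n+1}=1$. With $S=\sinh$ for $\mathbb H$ and $S=\sin$ for $\mathbb T$, the GB-splines of degree $1$ are $$N_{i,1}(x)=\frac{S(\mu(x-t_i))}{S(\mu(t_{i+1}-t_i))}\ \text{ on }[t_i,t_{i+1}),\qquad N_{i,1}(x)=\frac{S(\mu(t_{i+2}-x))}{S(\mu(t_{i+2}-t_{i+1}))}\ \text{ on }[t_{i+1},t_{i+2}),$$ and $N_{i,1}(x)=0$ elsewhere; for $q\ge 2$, $$N_{i,q}(x)=\frac{\int_0^x N_{i,q-1}(s)\,ds}{\int_0^1 N_{i,q-1}(s)\,ds}-\frac{\int_0^x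 N_{i+1,q-1}(s)\,ds}{\int_0^1 N_{i+1,q-1}(s)\,ds},$$ where a quotient belonging to some $N_{j,q-1}$ with $t_j=t_{j+q}$ is read as $1$ if $x\ge t_{j+q}$ and as $0$ otherwise. Write $N^{\mathbb Q_\mu}_{i,p}=N_{i,p}$ and define the symmetric matrices of order $n+p-2$ $$M^{\mathbb Q_\mu}_{n,p}=\Bigl[\,n\int_0^1 N^{\mathbb Q_\mu}_{j+1,p}N^{\mathbb Q_\mu}_{i+1,p}\,dx\Bigr]_{i,j=1}^{n+p-2},\qquad K^{\mathbb Q_\mu}_{n,p}=\Bigl[\,\frac1n\int_0^1 (N^{\mathbb Q_\mu}_{j+1,p})'(N^{\mathbb Q_\mu}_{i+1,p})'\,dx\Bigr]_{i,j=1}^{n+p-2}.$$ There is a constant $C>0$, depending only on $p$, $\mathbb Q$, $\alpha$ and the case (nested or non-nested), but not on $n$ or $\mathbf x$, such that for all admissible $n\ge2$ and all $\mathbf x\in\mathbb R^{n+p-2}$ $$C\,\frac{\|\mathbf x\|^2}{n}\le\Bigl\|\sum_{i=1}^{n+p-2}x_iN^{\mathbb Q_\mu}_{i+1,p}\Bigr\|^2_{L_2([0,1])}.\qquad(*)$$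 Moreover, whenever $C_p^{\mathbb Q_\nu}\ge0$ is a constant for which $(*)$ holds (with $C=C_p^{\mathbb Q_\nu}$) for all admissible $n\ge 2$ and all $\mathbf x$, then for every admissible $n\ge2$: 1. $\lambda_{\min}(M^{\mathbb Q_\mu}_{n,p})\ge C_p^{\mathbb Q_\nu}$; 2. $K^{\mathbb Q_\mu}_{n,p}\ge\frac{\pi^2}{n^2}M^{\mathbb Q_\mu}_{n,p}$ in the Loewner order, and $\lambda_{\min}(K^{\mathbb Q_\mu}_{n,p})\ge\frac{\pi^2C_p^{\mathbb Q_\nu}}{n^2}$. -/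

import Mathlib

open scoped MatrixOrder

noncomputable section

namespace GBSpline

/-- The two kinds of generalized B-splines: the section space of degree `p` and parameter `μ` is
spanned by `1, x, …, x ^ (p - 2)` together with `cosh (μ x), sinh (μ x)` (hyperbolic) or with
`cos (μ x), sin (μ x)` (trigonometric). -/
inductive Family
  | hyperbolic
  | trigonometric

/-- The odd function of the family, `sinh` or `sin`. -/
def Family.sine : Family → ℝ → ℝ
  | .hyperbolic => Real.sinh
  | .trigonometric => Real.sin

/-- The parameter `μ` is admissible on a uniform partition of `[0,1]` into `n` intervals:
`μ > 0` and, in the trigonometric case, `μ / n < π`, so that `cos (μ x), sin (μ x)` form a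
Chebyshev system on every knot interval. -/
def Family.Admissible : Family → ℝ → ℕ → Prop
  | .hyperbolic, μ, _ => 0 < μ
  | .trigonometric, μ, n => 0 < μ ∧ μ < n * Real.pi

/-- How the parameter varies with `n`. -/
inductive Regime
  | nonNested
  | nested

/-- The parameter used on the partition into `n` intervals: `n α` in the non-nested case and the
fixed `α` in the nested case. -/
def Regime.param : Regime → ℝ → ℕ → ℝ
  | .nonNested, α, n => n * α
  | .nested, α, _ => α

/-- The open uniform knot sequence, indexed from `1` to `n + 2 p + 1`:
`t₁ = ⋯ = t_{p+1} = 0`, `t_{p+1+i} = i / n` for `0 ≤ i ≤ n`, and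
`t_{p+n+1} = ⋯ = t_{2p+n+1} = 1`. -/
def knot (n p i : ℕ) : ℝ :=
  max 0 (min 1 (((i : ℝ) - (p + 1)) / n))

/-- For `a < b`, the element of `⟨cosh (μ x), sinh (μ x)⟩`, resp. `⟨cos (μ x), sin (μ x)⟩`, with
value `0` at `a` and value `1` at `b`. -/
def rise (F : Family) (μ a b x : ℝ) : ℝ :=
  F.sine (μ * (x - a)) / F.sine (μ * (b - a))

/-- For `a < b`, the element of the same space with value `1` at `a` and value `0` at `b`. -/
def fall (F : Family) (μ a b x : ℝ) : ℝ :=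
  F.sine (μ * (b - x)) / F.sine (μ * (b - a))

/-- The primitive from `0` of `f`, divided by the integral of `f` over `[0,1]`.
If the support `[a,b]` of `f` degenerates to a point, it is the unit step at that point. -/
def normalizedPrimitive (f : ℝ → ℝ) (a b x : ℝ) : ℝ :=
  if a = b then (if b ≤ x then 1 else 0)
  else (∫ s in (0 : ℝ)..x, f s) / (∫ s in (0 : ℝ)..1, f s)

/-- The `i`-th generalized B-spline of degree `q` over the knots `t`; its support is
`[t i, t (i + q + 1)]`. The recursion starts in degree `1`; the value in degree `0` is a dummy. -/
def basisFun (F : Family) (μ : ℝ) (t : ℕ → ℝ) : ℕ → ℕ → ℝ → ℝ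
  | 0, _, _ => 0
  | 1, i, x =>
      if t i ≤ x ∧ x < t (i + 1) then rise F μ (t i) (t (i + 1)) x
      else if t (i + 1) ≤ x ∧ x < t (i + 2) then fall F μ (t (i + 1)) (t (i + 2)) x
      else 0
  | q + 2, i, x =>
      normalizedPrimitive (basisFun F μ t (q + 1) i) (t i) (t (i + q + 2)) x
        - normalizedPrimitive (basisFun F μ t (q + 1) (i + 1)) (t (i + 1)) (t (i + q + 3)) x

/-- The `i`-th generalized B-spline of degree `p`, `1 ≤ i ≤ n + p`, over the open uniform knots
on `[0,1]`. -/
def spline (F : Family) (μ : ℝ) (n p i : ℕ) : ℝ → ℝ :=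
  basisFun F μ (knot n p) p i

/-- The splines numbered `2, …, n + p - 1`, that is, those vanishing at `0` and `1`,
indexed from `0`. -/
def interiorSpline (F : Family) (μ : ℝ) (n p : ℕ) (i : Fin (n + p - 2)) : ℝ → ℝ :=
  spline F μ n p (i + 2)

/-- The (scaled) mass matrix `M`: its entries are `n ∫₀¹ N_j N_i`. -/
def massMatrix (F : Family) (μ : ℝ) (n p : ℕ) :
    Matrix (Fin (n + p - 2)) (Fin (n + p - 2)) ℝ :=
  Matrix.of fun i j =>
    n * ∫ x in (0 : ℝ)..1, interiorSpline F μ n p j x * interiorSpline F μ n p i x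

/-- The (scaled) stiffness matrix `K`: its entries are `(1 / n) ∫₀¹ N_j' N_i'`. -/
def stiffnessMatrix (F : Family) (μ : ℝ) (n p : ℕ) :
    Matrix (Fin (n + p - 2)) (Fin (n + p - 2)) ℝ :=
  Matrix.of fun i j =>
    (1 / n) * ∫ x in (0 : ℝ)..1,
      deriv (interiorSpline F μ n p j) x * deriv (interiorSpline F μ n p i) x

theorem massMatrix_isHermitian (F : Family) (μ : ℝ) (n p : ℕ) :
    (massMatrix F μ n p).IsHermitian := by
  ext i j
  simp [massMatrix, mul_comm]

theorem stiffnessMatrix_isHermitian (F : Family) (μ : ℝ) (n p : ℕ) :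
    (stiffnessMatrix F μ n p).IsHermitian := by
  ext i j
  simp [stiffnessMatrix, mul_comm]

/-- The smallest eigenvalue of a real symmetric matrix. -/
def lambdaMin {m : ℕ} {A : Matrix (Fin m) (Fin m) ℝ} (hA : A.IsHermitian) : ℝ :=
  ⨅ i, hA.eigenvalues i

/-- `C` is a lower stability constant of the generalized B-spline bases of degree `p`, uniformly
in `n`: `C ‖x‖² / n ≤ ‖∑ xᵢ Nᵢ‖²` in `L²([0,1])`, for all admissible `n ≥ 2` and all `x`. -/
def IsStabilityConstant (F : Family) (R : Regime) (α : ℝ) (p : ℕ) (C : ℝ) : Prop :=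
  0 ≤ C ∧ ∀ n : ℕ, 2 ≤ n → F.Admissible (R.param α n) n → ∀ x : Fin (n + p - 2) → ℝ,
    C * (∑ i, x i ^ 2) / n ≤
      ∫ s in (0 : ℝ)..1, (∑ i, x i * interiorSpline F (R.param α n) n p i s) ^ 2

end GBSpline

end

/-! Everything reduces to quadratic forms. With `s = ∑ xᵢ Nᵢ`, the form of `massMatrix` is `n ∫ s²`
and that of `stiffnessMatrix` is `(1/n) ∫ s'²`. A stability constant is therefore a lower bound for
the first form. Since `s` vanishes at `0` and `1`, the Wirtinger inequality `π² ∫ s² ≤ ∫ s'²`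
compares the two forms. The substance is the existence of a stability constant independent of `n`.

That constant comes from local stability: on a knot interval of length `h`, each coefficient of a
spline active there is at most a constant times `sup |s|` on this interval. The proof is by
induction on the degree (`SplineFacts.stable_succ`). By summation by parts the coefficients of `s'`
are `(cⱼ - cⱼ₋₁) / mass`. A Markov inequality `|s'| ≤ (B/h) sup |s|` and the induction hypothesis
bound these quotients, and `mass = O(h)` cancels the factor `1/h`. So neighbouring coefficients
differ by `O(sup |s|)`, and the partition of unity, with nonnegative terms, bounds one of them. The
Markov inequality also passes from the maximum norm to `L²` on each interval, and summation over the
intervals finishes the estimate.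

Nonnegativity of the splines is obtained from a Descartes rule: a combination of `m` consecutive
splines has no `m + 1` points of alternating sign, and in the extremal case the rightmost sign is
that of the last coefficient. In degree one this is total positivity of the pair `fall, rise`;
Rolle's theorem raises the degree.

The constants depend only on the degree, on a bound `L = α²` for `μ² h²`, and on a bound `M` for the
splines of degree one. In the trigonometric case `M` is uniform in `n` because the admissible values
of `μ(n)/n` stay away from `π`. -/

noncomputable section

namespace GBSpline

/-! ### The generating functions -/

/-- The even function of the family, `cosh` or `cos`. -/
def Family.cosine : Family → ℝ → ℝ
  | .hyperbolic => Real.cosh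
  | .trigonometric => Real.cos

/-- The sign in `sine'' = ± sine`. -/
def Family.sign : Family → ℝ
  | .hyperbolic => 1
  | .trigonometric => -1

theorem Family.abs_sign (F : Family) : |F.sign| = 1 := by
  cases F <;> simp [Family.sign]

theorem Family.hasDerivAt_sine (F : Family) (x : ℝ) : HasDerivAt F.sine (F.cosine x) x := by
  cases F
  · exact Real.hasDerivAt_sinh x
  · exact Real.hasDerivAt_sin x

theorem Family.hasDerivAt_cosine (F : Family) (x : ℝ) :
    HasDerivAt F.cosine (F.sign * F.sine x) x := by
  cases F
  · exact (Real.hasDerivAt_cosh x).congr_deriv (by simp [Family.sign, Family.sine])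
  · exact (Real.hasDerivAt_cos x).congr_deriv (by simp [Family.sign, Family.sine])

theorem Family.sine_zero (F : Family) : F.sine 0 = 0 := by
  cases F <;> simp [Family.sine]

/-- The addition theorem behind the total positivity of the pair `fall, rise`. -/
theorem Family.sine_mul_sub (F : Family) (a b x y : ℝ) :
    F.sine (b - x) * F.sine (y - a) - F.sine (b - y) * F.sine (x - a)
      = F.sine (b - a) * F.sine (y - x) := by
  cases F
  · simp only [Family.sine, Real.sinh_sub]
    ring
  · simp only [Family.sine, Real.sin_sub]
    ring

/-! ### Local section spaces -/

/-- The section space of degree `q + 1` with parameter `κ = ± μ²`, described by differential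
equations: `f'' = κ f` for `q = 0`, and `f'` in the previous space otherwise. -/
def IsSection (κ : ℝ) : ℕ → (ℝ → ℝ) → Prop
  | 0, f => ∃ g : ℝ → ℝ, (∀ x, HasDerivAt f (g x) x) ∧ ∀ x, HasDerivAt g (κ * f x) x
  | q + 1, f => ∃ g : ℝ → ℝ, IsSection κ q g ∧ ∀ x, HasDerivAt f (g x) x

theorem IsSection.continuous {κ : ℝ} {q : ℕ} {f : ℝ → ℝ} (h : IsSection κ q f) :
    Continuous f := by
  cases q with
  | zero =>
    obtain ⟨g, hg, -⟩ := h
    exact continuous_iff_continuousAt.2 fun x => (hg x).continuousAt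
  | succ q =>
    obtain ⟨g, -, hg⟩ := h
    exact continuous_iff_continuousAt.2 fun x => (hg x).continuousAt

theorem IsSection.add {κ : ℝ} {q : ℕ} {f₁ f₂ : ℝ → ℝ} (h₁ : IsSection κ q f₁)
    (h₂ : IsSection κ q f₂) : IsSection κ q (fun x => f₁ x + f₂ x) := by
  induction q generalizing f₁ f₂ with
  | zero =>
    obtain ⟨g₁, a₁, b₁⟩ := h₁
    obtain ⟨g₂, a₂, b₂⟩ := h₂
    refine ⟨fun x => g₁ x + g₂ x, fun x => (a₁ x).add (a₂ x), fun x => ?_⟩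
    rw [mul_add]
    exact (b₁ x).add (b₂ x)
  | succ q ih =>
    obtain ⟨g₁, a₁, b₁⟩ := h₁
    obtain ⟨g₂, a₂, b₂⟩ := h₂
    exact ⟨_, ih a₁ a₂, fun x => (b₁ x).add (b₂ x)⟩

theorem IsSection.const_mul {κ : ℝ} {q : ℕ} {f : ℝ → ℝ} (c : ℝ) (h : IsSection κ q f) :
    IsSection κ q (fun x => c * f x) := by
  induction q generalizing f with
  | zero =>
    obtain ⟨g, a, b⟩ := h
    refine ⟨fun x => c * g x, fun x => (a x).const_mul c, fun x => ?_⟩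
    rw [mul_left_comm]
    exact (b x).const_mul c
  | succ q ih =>
    obtain ⟨g, a, b⟩ := h
    exact ⟨_, ih a, fun x => (b x).const_mul c⟩

theorem IsSection.zero (κ : ℝ) (q : ℕ) : IsSection κ q (fun _ => 0) := by
  induction q with
  | zero => exact ⟨fun _ => 0, fun x => hasDerivAt_const x 0, fun x => by
      simpa using hasDerivAt_const x (0 : ℝ)⟩
  | succ q ih => exact ⟨_, ih, fun x => hasDerivAt_const x 0⟩

theorem IsSection.sum {κ : ℝ} {q : ℕ} {ι : Type*} (s : Finset ι) (c : ι → ℝ) {f : ι → ℝ → ℝ}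
    (h : ∀ i ∈ s, IsSection κ q (f i)) : IsSection κ q (fun x => ∑ i ∈ s, c i * f i x) := by
  classical
  induction s using Finset.induction_on with
  | empty => simpa using IsSection.zero κ q
  | insert a s ha ih =>
    simp only [Finset.sum_insert ha]
    exact ((h a (by simp)).const_mul _).add (ih fun i hi => h i (by simp [hi]))

theorem Family.isSection_sine (F : Family) (μ c : ℝ) :
    IsSection (F.sign * μ ^ 2) 0 (fun x => F.sine (μ * (x - c))) := by
  have hl : ∀ x, HasDerivAt (fun x : ℝ => μ * (x - c)) μ x := fun x => by
    simpa using ((hasDerivAt_id x).sub_const c).const_mul μ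
  refine ⟨fun x => F.cosine (μ * (x - c)) * μ,
    fun x => (F.hasDerivAt_sine _).comp x (hl x), fun x => ?_⟩
  have := ((F.hasDerivAt_cosine (μ * (x - c))).comp x (hl x)).mul_const μ
  exact this.congr_deriv (by ring)

theorem Family.sine_neg (F : Family) (x : ℝ) : F.sine (-x) = -F.sine x := by
  cases F <;> simp [Family.sine]

theorem isSection_rise (F : Family) (μ a b : ℝ) :
    IsSection (F.sign * μ ^ 2) 0 (rise F μ a b) := by
  have := (F.isSection_sine μ a).const_mul (F.sine (μ * (b - a)))⁻¹
  convert this using 2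
  rw [rise, div_eq_inv_mul]

theorem isSection_fall (F : Family) (μ a b : ℝ) :
    IsSection (F.sign * μ ^ 2) 0 (fall F μ a b) := by
  have := (F.isSection_sine μ b).const_mul (-(F.sine (μ * (b - a)))⁻¹)
  convert this using 2
  rename_i x
  rw [fall, div_eq_inv_mul, show μ * (b - x) = -(μ * (x - b)) by ring, F.sine_neg]
  ring

/-! ### A Markov inequality -/

/-- The constant in the Markov inequality for sections of degree `q + 1`, if `|κ| h² ≤ L` on an
interval of length `h`. -/
def markovConst (L : ℝ) : ℕ → ℝ
  | 0 => 2 + L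
  | q + 1 => 4 * max 1 (2 * markovConst L q)

theorem markovConst_pos {L : ℝ} (hL : 0 ≤ L) (q : ℕ) : 0 < markovConst L q := by
  cases q with
  | zero => unfold markovConst; linarith
  | succ q =>
    unfold markovConst
    have : (1 : ℝ) ≤ max 1 (2 * markovConst L q) := le_max_left _ _
    linarith

theorem exists_subinterval {a b η x : ℝ} (hη : 0 < η) (hab : η ≤ b - a)
    (hx : x ∈ Set.Icc a b) : ∃ u, a ≤ u ∧ u + η ≤ b ∧ u ≤ x ∧ x ≤ u + η := by
  rcases le_total x (a + η) with h | h
  · exact ⟨a, le_rfl, by linarith, hx.1, h⟩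
  · exact ⟨x - η, by linarith, by linarith [hx.2], by linarith, by linarith⟩

/-- If `|f| ≤ A` and `|f''| ≤ H`, then `|f'| ≤ 2 A / η + η H` for every `η` up to the length of
the interval. -/
theorem abs_deriv_le_of_abs_le {f g k : ℝ → ℝ} {a b A H η : ℝ} (hη : 0 < η) (hab : η ≤ b - a)
    (hf : ∀ x, HasDerivAt f (g x) x) (hg : ∀ x, HasDerivAt g (k x) x)
    (hA : ∀ x ∈ Set.Icc a b, |f x| ≤ A) (hH : ∀ x ∈ Set.Icc a b, |k x| ≤ H)
    {x : ℝ} (hx : x ∈ Set.Icc a b) : |g x| ≤ 2 * A / η + η * H := by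
  obtain ⟨u, hu1, hu2, hu3, hu4⟩ := exists_subinterval hη hab hx
  obtain ⟨ξ, hξ, hξ'⟩ := exists_hasDerivAt_eq_slope f g (show u < u + η by linarith)
    (continuous_iff_continuousAt.2 fun x => (hf x).continuousAt).continuousOn
    (fun y _ => hf y)
  have h1 : |g ξ| ≤ 2 * A / η := by
    rw [hξ', abs_div, show |u + η - u| = η by rw [add_sub_cancel_left, abs_of_pos hη]]
    gcongr
    have := abs_sub (f (u + η)) (f u)
    linarith [hA u ⟨hu1, by linarith⟩, hA (u + η) ⟨by linarith, hu2⟩]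
  have h2 : ‖g x - g ξ‖ ≤ H * ‖x - ξ‖ :=
    (convex_Icc a b).norm_image_sub_le_of_norm_hasDerivWithin_le
      (fun y _ => (hg y).hasDerivWithinAt) (fun y hy => hH y hy)
      ⟨by linarith [hξ.1], by linarith [hξ.2]⟩ hx
  have h3 : |x - ξ| ≤ η := by
    rw [abs_le]; constructor <;> linarith [hξ.1, hξ.2]
  have hH0 : 0 ≤ H := (abs_nonneg _).trans (hH x hx)
  rw [Real.norm_eq_abs, Real.norm_eq_abs] at h2
  have h4 : H * |x - ξ| ≤ H * η := by gcongr
  have h5 := abs_sub_abs_le_abs_sub (g x) (g ξ)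
  linarith

/-- In the lowest degree `f'' = κ f` supplies the bound on the second derivative. In higher degree
`f'` is itself a section, so the induction hypothesis bounds `f''` by the maximum of `|f'|`, and
this term is absorbed. -/
theorem IsSection.abs_deriv_le {κ L h : ℝ} (hh : 0 < h) (hL : |κ| * h ^ 2 ≤ L) {q : ℕ} :
    ∀ {f g : ℝ → ℝ} {a A : ℝ}, IsSection κ q f → (∀ x, HasDerivAt f (g x) x) →
      (∀ x ∈ Set.Icc a (a + h), |f x| ≤ A) →
      ∀ x ∈ Set.Icc a (a + h), |g x| ≤ markovConst L q / h * A := by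
  have hL0 : 0 ≤ L := le_trans (by positivity) hL
  induction q with
  | zero =>
    rintro f g a A ⟨g', h1, h2⟩ hf hA x hx
    obtain rfl : g' = g := funext fun x => (h1 x).unique (hf x)
    have hA0 : 0 ≤ A := (abs_nonneg _).trans (hA x hx)
    have := abs_deriv_le_of_abs_le (H := |κ| * A) hh (by linarith) h1 h2 hA
      (fun y hy => by rw [abs_mul]; gcongr; exact hA y hy) hx
    refine this.trans ?_
    have e : h * (|κ| * A) = |κ| * h ^ 2 * A / h := by field_simp
    rw [e, markovConst, div_mul_eq_mul_div, ← add_div, add_mul]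
    gcongr
  | succ q ih =>
    rintro f g a A ⟨g', h1, h2⟩ hf hA
    obtain rfl : g' = g := funext fun x => (h2 x).unique (hf x)
    obtain ⟨x₀, hx₀, hmax⟩ := (isCompact_Icc (a := a) (b := a + h)).exists_isMaxOn
      ⟨a, by simp [hh.le]⟩ (h1.continuous.abs.continuousOn)
    have hmax' : ∀ y ∈ Set.Icc a (a + h), |g' y| ≤ |g' x₀| := fun y hy => hmax hy
    obtain ⟨k, hk⟩ : ∃ k : ℝ → ℝ, ∀ x, HasDerivAt g' (k x) x := by
      cases q with
      | zero => obtain ⟨k, hk, -⟩ := h1; exact ⟨k, hk⟩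
      | succ q => obtain ⟨k, -, hk⟩ := h1; exact ⟨k, hk⟩
    have hkb := ih h1 hk hmax'
    set B := markovConst L q
    set m := max 1 (2 * B) with hm
    have hm1 : 1 ≤ m := le_max_left _ _
    have hm2 : 2 * B ≤ m := le_max_right _ _
    have hm0 : 0 < m := by linarith
    have hle : h / m ≤ h := div_le_self hh.le hm1
    -- With `η = h / m` the contribution of `f''` is at most half the maximum of `|f'|`, which is
    -- attained at `x₀`; `1 ≤ m` keeps `η` within the interval.
    have := abs_deriv_le_of_abs_le (η := h / m) (by positivity) (by linarith) h2 hk hA hkb hx₀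
    have e1 : h / m * (B / h * |g' x₀|) = B / m * |g' x₀| := by field_simp
    have e2 : B / m ≤ 1 / 2 := by rw [div_le_iff₀ hm0]; linarith
    have e3 : B / m * |g' x₀| ≤ 1 / 2 * |g' x₀| := by gcongr
    have e4 : 2 * A / (h / m) = 2 * m / h * A := by field_simp
    intro x hx
    refine (hmax' x hx).trans ?_
    rw [e1, e4] at this
    have e5 : markovConst L (q + 1) / h * A = 2 * (2 * m / h * A) := by
      rw [markovConst]; ring
    rw [e5]
    linarith

/-! ### Sign alternations -/

/-- `f` alternates in sign at `l` points of `(0, x)`; `σ` is the sign at the rightmost one. -/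
def Alternates (f : ℝ → ℝ) : ℕ → ℝ → ℝ → Prop
  | 0, _, _ => True
  | l + 1, σ, x => ∃ y, 0 < y ∧ y < x ∧ 0 < σ * f y ∧ Alternates f l (-σ) y

theorem Alternates.mono {f : ℝ → ℝ} {l : ℕ} {σ x x' : ℝ} (h : Alternates f l σ x)
    (hx : x ≤ x') : Alternates f l σ x' := by
  cases l with
  | zero => trivial
  | succ l =>
    obtain ⟨y, h0, h1, h2⟩ := h
    exact ⟨y, h0, h1.trans_le hx, h2⟩

theorem Alternates.congr {f g : ℝ → ℝ} {l : ℕ} {σ x : ℝ} (h : Alternates f l σ x)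
    (hfg : Set.EqOn f g (Set.Ioo 0 x)) : Alternates g l σ x := by
  induction l generalizing σ x with
  | zero => trivial
  | succ l ih =>
    obtain ⟨y, h0, h1, h2, h3⟩ := h
    refine ⟨y, h0, h1, ?_, ih h3 (hfg.mono (Set.Ioo_subset_Ioo_right h1.le))⟩
    rwa [← hfg ⟨h0, h1⟩]

theorem exists_pos_of_integral_pos {f : ℝ → ℝ} {σ z y : ℝ} (hzy : z ≤ y)
    (h : 0 < σ * ∫ x in z..y, f x) : ∃ w, z < w ∧ w < y ∧ 0 < σ * f w := by
  by_contra! hcon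
  rw [← intervalIntegral.integral_const_mul, intervalIntegral.integral_of_le hzy,
    MeasureTheory.integral_Ioc_eq_integral_Ioo] at h
  exact absurd h (not_lt.2 (MeasureTheory.setIntegral_nonpos measurableSet_Ioo
    fun x hx => hcon x hx.1 hx.2))

/-! ### Rolle's theorem for sign alternations. -/

section Rolle

variable {F f : ℝ → ℝ}

/-- Between consecutive points of opposite sign the increment of `F` has the sign at the right one,
and so has its integrand `f` somewhere in between. A zero of `F` at `0` acts as one more point.
Alternations are counted instead of zeros because splines may vanish on whole intervals. -/
theorem Alternates.of_primitive_aux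
    (hF : ∀ z y, 0 ≤ z → z ≤ y → y ≤ 1 → F y - F z = ∫ x in z..y, f x)
    {k : ℕ} (hk : k = 0 ∨ k = 1 ∧ F 0 = 0) {l : ℕ} {σ y : ℝ} (hy0 : 0 < y) (hy1 : y ≤ 1)
    (hy : 0 < σ * F y) (h : Alternates F l (-σ) y) : Alternates f (l + k) σ y := by
  induction l generalizing σ y with
  | zero =>
    rcases hk with rfl | ⟨rfl, h0⟩
    · trivial
    · have := hF 0 y le_rfl hy0.le hy1
      rw [h0, sub_zero] at this
      rw [this] at hy
      obtain ⟨w, h1, h2, h3⟩ := exists_pos_of_integral_pos hy0.le hy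
      exact ⟨w, h1, h2, h3, trivial⟩
  | succ l ih =>
    obtain ⟨z, hz0, hzy, hz, h'⟩ := h
    have hpos : 0 < σ * ∫ x in z..y, f x := by
      rw [← hF z y hz0.le hzy.le hy1]; linarith
    obtain ⟨w, h1, h2, h3⟩ := exists_pos_of_integral_pos hzy.le hpos
    rw [Nat.add_right_comm]
    exact ⟨w, hz0.trans h1, h2, h3, (ih hz0 (hzy.le.trans hy1) hz h').mono h1.le⟩

/-- Rolle's theorem for sign alternations, without use of the right end point. -/
theorem Alternates.of_primitive
    (hF : ∀ z y, 0 ≤ z → z ≤ y → y ≤ 1 → F y - F z = ∫ x in z..y, f x)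
    {k : ℕ} (hk : k = 0 ∨ k = 1 ∧ F 0 = 0) {l : ℕ} {σ : ℝ}
    (h : Alternates F (l + 1) σ 1) : Alternates f (l + k) σ 1 := by
  obtain ⟨y, h0, h1, h2, h3⟩ := h
  exact (of_primitive_aux hF hk h0 h1.le h2 h3).mono h1.le

/-- Rolle's theorem for sign alternations, with use of the right end point. -/
theorem Alternates.of_primitive_right
    (hF : ∀ z y, 0 ≤ z → z ≤ y → y ≤ 1 → F y - F z = ∫ x in z..y, f x)
    {k : ℕ} (hk : k = 0 ∨ k = 1 ∧ F 0 = 0) {l : ℕ} {σ : ℝ} (hσ : σ * F 1 ≤ 0)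
    (h : Alternates F (l + 1) σ 1) : Alternates f (l + k + 1) (-σ) 1 := by
  obtain ⟨y, h0, h1, h2, h3⟩ := h
  have hpos : 0 < (-σ) * ∫ x in y..1, f x := by
    rw [← hF y 1 h0.le h1.le le_rfl]; linarith
  obtain ⟨w, w1, w2, w3⟩ := exists_pos_of_integral_pos h1.le hpos
  refine ⟨w, h0.trans w1, w2, w3, ?_⟩
  rw [neg_neg]
  exact (of_primitive_aux hF hk h0 h1.le h2 h3).mono w1.le

end Rolle

/-- Combinations of `m` consecutive members of the family have no alternation of length
`m + 1`. -/
def AlternationBound (N : ℕ → ℝ → ℝ) : Prop :=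
  ∀ (c : ℕ → ℝ) (a m : ℕ) (σ : ℝ), (∀ j < a, c j = 0) →
    ¬ Alternates (fun x => ∑ j ∈ Finset.range (a + m), c j * N j x) (m + 1) σ 1

/-- If a combination of `m + 1` consecutive members of the family alternates `m + 1` times, then
its rightmost sign is that of the last coefficient. -/
def AlternationOriented (N : ℕ → ℝ → ℝ) (t : ℕ → ℝ) : Prop :=
  ∀ (c : ℕ → ℝ) (a m : ℕ) (σ : ℝ), (∀ j < a, c j = 0) → t (a + m) < 1 →
    Alternates (fun x => ∑ j ∈ Finset.range (a + m + 1), c j * N j x) (m + 1) σ 1 →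
    0 < σ * c (a + m)

/-! ### Knots -/

/-- Open knot sequences in `[0,1]` with simple equidistant interior knots of distance `h`, for
which the section spaces of parameter `μ` are Chebyshev systems on every knot interval. -/
structure IsGrid (F : Family) (μ : ℝ) (t : ℕ → ℝ) (p : ℕ) (h : ℝ) : Prop where
  monotone : Monotone t
  eq_zero : ∀ i ≤ p + 1, t i = 0
  le_one : ∀ i, t i ≤ 1
  exists_eq_one : ∃ i, t i = 1
  step : ∀ i, t i < t (i + 1) → t (i + 1) - t i = h
  simple : ∀ i, 0 < t i → t i < 1 → t i < t (i + 1)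
  pos : 0 < h
  sine_pos : ∀ x, 0 < x → x ≤ h → 0 < F.sine (μ * x)

namespace IsGrid

variable {F : Family} {μ : ℝ} {t : ℕ → ℝ} {p : ℕ} {h : ℝ}

theorem nonneg (G : IsGrid F μ t p h) (i : ℕ) : 0 ≤ t i := by
  rw [← G.eq_zero 0 (by omega)]
  exact G.monotone (Nat.zero_le i)

theorem exists_index (G : IsGrid F μ t p h) {x : ℝ} (h0 : 0 ≤ x) (h1 : x < 1) :
    ∃ k, t (k + 1) ≤ x ∧ x < t (k + 2) := by
  classical
  obtain ⟨i, hi⟩ := G.exists_eq_one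
  have hex : ∃ k, x < t k := ⟨i, by rwa [hi]⟩
  have hs := Nat.find_spec hex
  have hm : ∀ k < Nat.find hex, t k ≤ x := fun k hk => not_lt.1 (Nat.find_min hex hk)
  have h2 : 2 ≤ Nat.find hex := by
    by_contra! hlt
    have := G.eq_zero (Nat.find hex) (by omega)
    linarith
  obtain ⟨k, hk⟩ := Nat.exists_eq_add_of_le' h2
  rw [hk] at hs hm
  exact ⟨k, hm _ (by omega), hs⟩

theorem lt_index (G : IsGrid F μ t p h) {m : ℕ} (hm : t m < t (m + 1)) : p + 1 ≤ m := by
  by_contra! hlt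
  rw [G.eq_zero m (by omega), G.eq_zero (m + 1) (by omega)] at hm
  exact lt_irrefl _ hm

theorem le_add_mul (G : IsGrid F μ t p h) (i k : ℕ) : t (i + k) ≤ t i + k * h := by
  induction k with
  | zero => simp
  | succ k ih =>
    have : t (i + (k + 1)) ≤ t (i + k) + h := by
      rcases (G.monotone (show i + k ≤ i + (k + 1) by omega)).lt_or_eq with h1 | h1
      · have := G.step (i + k) h1
        rw [← add_assoc]; linarith
      · linarith [G.pos]
    push_cast
    linarith

/-- Interior knots are simple, so supports degenerate only at the ends of `[0,1]`. -/
theorem eq_zero_or_one (G : IsGrid F μ t p h) {i q : ℕ} (hi : t i = t (i + q + 1)) :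
    t (i + q + 1) = 0 ∨ t i = 1 := by
  by_contra! hcon
  rw [← hi] at hcon
  have h1 := G.simple i (lt_of_le_of_ne (G.nonneg i) hcon.1.symm)
    (lt_of_le_of_ne (G.le_one i) hcon.2)
  have h2 := G.monotone (show i + 1 ≤ i + q + 1 by omega)
  linarith

end IsGrid

/-! ### Splines of degree one -/

section Hat

variable {F : Family} {μ : ℝ} {t : ℕ → ℝ} {p : ℕ} {h : ℝ}

theorem basisFun_one_rise {k : ℕ} {x : ℝ} (h1 : t k ≤ x) (h2 : x < t (k + 1)) :
    basisFun F μ t 1 k x = rise F μ (t k) (t (k + 1)) x := by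
  simp [basisFun, h1, h2]

theorem basisFun_one_fall {k : ℕ} {x : ℝ} (h1 : t (k + 1) ≤ x) (h2 : x < t (k + 2)) :
    basisFun F μ t 1 k x = fall F μ (t (k + 1)) (t (k + 2)) x := by
  simp [basisFun, h1, h2, not_lt.2 h1]

theorem basisFun_one_of_lt {k : ℕ} {x : ℝ} (ht : Monotone t) (h1 : x < t k) :
    basisFun F μ t 1 k x = 0 := by
  have := ht (show k ≤ k + 1 by omega)
  rw [basisFun, if_neg (by intro h; linarith [h.1]), if_neg (by intro h; linarith [h.1])]

theorem basisFun_one_of_le {k : ℕ} {x : ℝ} (ht : Monotone t) (h1 : t (k + 2) ≤ x) :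
    basisFun F μ t 1 k x = 0 := by
  have := ht (show k + 1 ≤ k + 2 by omega)
  rw [basisFun, if_neg (by intro h; linarith [h.2]), if_neg (by intro h; linarith [h.2])]

theorem sum_basisFun_one (ht : Monotone t) {k : ℕ} {x : ℝ} (h1 : t (k + 1) ≤ x)
    (h2 : x < t (k + 2)) {c : ℕ → ℝ} {b : ℕ}
    (hc : ∀ j, b ≤ j → j ≤ k + 1 → c j = 0) :
    ∑ j ∈ Finset.range b, c j * basisFun F μ t 1 j x
      = c k * fall F μ (t (k + 1)) (t (k + 2)) x
        + c (k + 1) * rise F μ (t (k + 1)) (t (k + 2)) x := by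
  rw [Finset.sum_eq_add k (k + 1) (by omega), basisFun_one_rise h1 h2, basisFun_one_fall h1 h2]
  · rintro j - ⟨hj1, hj2⟩
    rcases lt_or_ge j k with hjk | hjk
    · rw [basisFun_one_of_le ht ((ht (show j + 2 ≤ k + 1 by omega)).trans h1), mul_zero]
    · rw [basisFun_one_of_lt ht (h2.trans_le (ht (show k + 2 ≤ j by omega))), mul_zero]
  · intro hk
    rw [hc k (by simpa using hk) (by omega), zero_mul]
  · intro hk
    rw [hc (k + 1) (by simpa using hk) le_rfl, zero_mul]

theorem IsGrid.sine_sub_pos (G : IsGrid F μ t p h) {k : ℕ} {x y : ℝ} (h1 : t k ≤ x)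
    (h2 : y ≤ t (k + 1)) (hxy : x < y) : 0 < F.sine (μ * (y - x)) :=
  G.sine_pos _ (by linarith) (by have := G.step k (by linarith); linarith)

theorem IsGrid.sine_sub_nonneg (G : IsGrid F μ t p h) {k : ℕ} {x y : ℝ} (h1 : t k ≤ x)
    (h2 : y ≤ t (k + 1)) (hxy : x ≤ y) : 0 ≤ F.sine (μ * (y - x)) := by
  rcases hxy.lt_or_eq with hlt | rfl
  · exact (G.sine_sub_pos h1 h2 hlt).le
  · simp [F.sine_zero]

theorem IsGrid.rise_nonneg (G : IsGrid F μ t p h) {k : ℕ} {x : ℝ} (h1 : t k ≤ x)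
    (h2 : x ≤ t (k + 1)) : 0 ≤ rise F μ (t k) (t (k + 1)) x :=
  div_nonneg (G.sine_sub_nonneg le_rfl h2 h1)
    (G.sine_sub_nonneg le_rfl le_rfl (h1.trans h2))

theorem IsGrid.fall_nonneg (G : IsGrid F μ t p h) {k : ℕ} {x : ℝ} (h1 : t k ≤ x)
    (h2 : x ≤ t (k + 1)) : 0 ≤ fall F μ (t k) (t (k + 1)) x :=
  div_nonneg (G.sine_sub_nonneg h1 le_rfl h2)
    (G.sine_sub_nonneg le_rfl le_rfl (h1.trans h2))

/-- By the addition theorem the numerator is a product of two positive values of the sine function.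
This is the total positivity of the pair. -/
theorem IsGrid.fall_mul_rise_sub_pos (G : IsGrid F μ t p h) {k : ℕ} {x y : ℝ} (h1 : t k ≤ x)
    (hxy : x < y) (h2 : y ≤ t (k + 1)) :
    0 < fall F μ (t k) (t (k + 1)) x * rise F μ (t k) (t (k + 1)) y
      - fall F μ (t k) (t (k + 1)) y * rise F μ (t k) (t (k + 1)) x := by
  have hs := G.sine_sub_pos (le_refl (t k)) (le_refl (t (k + 1))) (by linarith)
  have hxy' := G.sine_sub_pos h1 h2 hxy
  have key := F.sine_mul_sub (μ * t k) (μ * t (k + 1)) (μ * x) (μ * y)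
  simp only [← mul_sub] at key
  unfold rise fall
  rw [div_mul_div_comm, div_mul_div_comm, ← sub_div, key]
  positivity

/-- Each alternation point is matched with a coefficient of the same sign among the two active
there. Moving to the right, these indices strictly increase, since neighbouring signs differ; hence
the index gains at least one per point. -/
theorem IsGrid.alternation_basisFun_one (G : IsGrid F μ t p h) {c : ℕ → ℝ} {a b : ℕ}
    (ha : ∀ j < a, c j = 0) (hb : ∀ j, b ≤ j → c j = 0) {l : ℕ} :
    ∀ {σ y : ℝ} {k : ℕ}, t (k + 1) ≤ y → y < t (k + 2) →
      0 < σ * ∑ j ∈ Finset.range b, c j * basisFun F μ t 1 j y →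
      Alternates (fun x => ∑ j ∈ Finset.range b, c j * basisFun F μ t 1 j x) l (-σ) y →
      ∃ j, (j = k ∨ j = k + 1) ∧ a + l ≤ j ∧ 0 < σ * c j := by
  have pick : ∀ {σ y : ℝ} {k : ℕ}, t (k + 1) ≤ y → y < t (k + 2) →
      0 < σ * ∑ j ∈ Finset.range b, c j * basisFun F μ t 1 j y →
      0 < σ * c (k + 1) ∨ 0 < σ * c k := by
    intro σ y k h1 h2 hs
    rw [sum_basisFun_one G.monotone h1 h2 fun j hj _ => hb j hj] at hs
    by_contra! hcon
    have := mul_nonneg (neg_nonneg.2 hcon.1) (G.rise_nonneg h1 h2.le)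
    have := mul_nonneg (neg_nonneg.2 hcon.2) (G.fall_nonneg h1 h2.le)
    linarith
  induction l with
  | zero =>
    intro σ y k h1 h2 hs _
    have hge : ∀ j, 0 < σ * c j → a + 0 ≤ j := by
      intro j hj
      by_contra! hlt
      rw [ha j (by omega), mul_zero] at hj
      exact lt_irrefl _ hj
    rcases pick h1 h2 hs with hp | hp
    · exact ⟨k + 1, Or.inr rfl, hge _ hp, hp⟩
    · exact ⟨k, Or.inl rfl, hge _ hp, hp⟩
  | succ l ih =>
    rintro σ y k h1 h2 hs ⟨z, hz0, hzy, hz, halt⟩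
    obtain ⟨k', hk1, hk2⟩ := G.exists_index hz0.le
      (hzy.trans (h2.trans_le (G.le_one _)))
    obtain ⟨j', hj', hj2, hj3⟩ := ih hk1 hk2 hz halt
    have hkk : k' ≤ k := by
      by_contra! hlt
      have := G.monotone (show k + 2 ≤ k' + 1 by omega)
      linarith
    have hne : ∀ j, 0 < σ * c j → j ≠ j' := by
      rintro j hj rfl
      linarith
    rcases pick h1 h2 hs with hp | hp
    · have := hne _ hp
      exact ⟨k + 1, Or.inr rfl, by omega, hp⟩
    · rcases hkk.lt_or_eq with hlt | rfl
      · have := hne _ hp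
        exact ⟨k, Or.inl rfl, by omega, hp⟩
      -- Both points lie in one knot interval and `c k'` has the sign at `y`, so the index could
      -- fail to increase. Eliminating `c k'` from the values at `z` and `y` leaves `c (k' + 1)`
      -- times a positive determinant, so `c (k' + 1)` has that sign as well.
      · have hd := G.fall_mul_rise_sub_pos hk1 hzy h2.le
        have hfz := G.fall_nonneg hk1 hk2.le
        have hfy := G.fall_nonneg h1 h2.le
        rw [sum_basisFun_one G.monotone h1 h2 fun j hj _ => hb j hj] at hs
        simp only [sum_basisFun_one G.monotone hk1 hk2 fun j hj _ => hb j hj] at hz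
        rw [show k' + 2 = k' + 1 + 1 from rfl] at hs hz
        set fz := fall F μ (t (k' + 1)) (t (k' + 1 + 1)) z
        set fy := fall F μ (t (k' + 1)) (t (k' + 1 + 1)) y
        set rz := rise F μ (t (k' + 1)) (t (k' + 1 + 1)) z
        set ry := rise F μ (t (k' + 1)) (t (k' + 1 + 1)) y
        have hfy0 : 0 < fy := by
          refine div_pos (G.sine_sub_pos h1 le_rfl h2) (G.sine_sub_pos le_rfl le_rfl ?_)
          exact h1.trans_lt h2
        have hpos : 0 < σ * c (k' + 1) * (fz * ry - fy * rz) := by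
          have e : σ * c (k' + 1) * (fz * ry - fy * rz)
            = fz * (σ * (c k' * fy + c (k' + 1) * ry))
              + fy * (-σ * (c k' * fz + c (k' + 1) * rz)) := by ring
          rw [e]
          have := mul_nonneg hfz hs.le
          have := mul_pos hfy0 hz
          linarith
        have hp' := pos_of_mul_pos_left hpos hd.le
        have := hne _ hp'
        exact ⟨k' + 1, Or.inr rfl, by omega, hp'⟩

theorem IsGrid.exists_of_alternates_basisFun_one (G : IsGrid F μ t p h) {c : ℕ → ℝ} {a b : ℕ}
    (ha : ∀ j < a, c j = 0) {l : ℕ} {σ : ℝ}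
    (hl : Alternates (fun x => ∑ j ∈ Finset.range b, c j * basisFun F μ t 1 j x) (l + 1) σ 1) :
    ∃ j, a + l ≤ j ∧ j < b ∧ 0 < σ * c j := by
  -- Truncation makes the two-term formula valid also where an active index lies outside the range.
  set c' : ℕ → ℝ := fun j => if j < b then c j else 0 with hc'
  have e : (fun x => ∑ j ∈ Finset.range b, c j * basisFun F μ t 1 j x)
      = fun x => ∑ j ∈ Finset.range b, c' j * basisFun F μ t 1 j x := by
    funext x
    refine Finset.sum_congr rfl fun j hj => ?_
    simp only [hc', if_pos (Finset.mem_range.1 hj)]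
  rw [e] at hl
  obtain ⟨y, h0, h1, h2, h3⟩ := hl
  obtain ⟨k, hk1, hk2⟩ := G.exists_index h0.le h1
  obtain ⟨j, -, hj, hj'⟩ := G.alternation_basisFun_one (c := c') (a := a) (b := b)
    (fun j hj => by simp only [hc', ha j hj, ite_self])
    (fun j hj => by simp only [hc', if_neg (not_lt.2 hj)]) hk1 hk2 h2 h3
  by_cases hjb : j < b
  · refine ⟨j, hj, hjb, ?_⟩
    simpa only [hc', if_pos hjb] using hj'
  · simp only [hc', if_neg hjb, mul_zero, lt_irrefl] at hj'

theorem IsGrid.alternationBound_one (G : IsGrid F μ t p h) :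
    AlternationBound (basisFun F μ t 1) := by
  intro c a m σ ha hl
  obtain ⟨j, h1, h2, -⟩ := G.exists_of_alternates_basisFun_one ha hl
  omega

theorem IsGrid.alternationOriented_one (G : IsGrid F μ t p h) :
    AlternationOriented (basisFun F μ t 1) t := by
  intro c a m σ ha _ hl
  obtain ⟨j, h1, h2, h3⟩ := G.exists_of_alternates_basisFun_one ha hl
  obtain rfl : j = a + m := by omega
  exact h3

end Hat

/-- The constant in the local stability estimate for splines of degree `q + 1`. -/
def stabConst (M L : ℝ) : ℕ → ℝ
  | 0 => 1
  | q + 1 => 1 + 2 * (q + 2) * ((q + 2) * M * (stabConst M L q * markovConst L (q + 1)))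

/-- The properties of the splines of degree `q + 1` that are carried through the recursion. -/
structure SplineFacts (F : Family) (μ : ℝ) (t : ℕ → ℝ) (M L : ℝ) (q : ℕ) : Prop where
  integrable : ∀ i a b, IntervalIntegrable (basisFun F μ t (q + 1) i) MeasureTheory.volume a b
  continuousOn : ∀ i, ContinuousOn (basisFun F μ t (q + 1) i) (Set.Ioo 0 1)
  left : ∀ i, ∀ x ∈ Set.Ioo (0 : ℝ) 1, x < t i → basisFun F μ t (q + 1) i x = 0
  right : ∀ i, ∀ x ∈ Set.Ioo (0 : ℝ) 1, t (i + q + 2) ≤ x → basisFun F μ t (q + 1) i x = 0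
  nonneg : ∀ i, ∀ x ∈ Set.Ioo (0 : ℝ) 1, 0 ≤ basisFun F μ t (q + 1) i x
  le : ∀ i, ∀ x ∈ Set.Ioo (0 : ℝ) 1, basisFun F μ t (q + 1) i x ≤ M
  piece : ∀ i m, t m < t (m + 1) → ∃ f, IsSection (F.sign * μ ^ 2) q f ∧
    Set.EqOn (basisFun F μ t (q + 1) i) f (Set.Ioo (t m) (t (m + 1)))
  bound : AlternationBound (basisFun F μ t (q + 1))
  oriented : AlternationOriented (basisFun F μ t (q + 1)) t
  stable : ∀ m K, t m < t (m + 1) → m < K → ∀ (c : ℕ → ℝ) (A : ℝ),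
    (∀ x ∈ Set.Ioo (t m) (t (m + 1)),
      |∑ i ∈ Finset.range K, c i * basisFun F μ t (q + 1) i x| ≤ A) →
    ∀ i, i ≤ m → m ≤ i + q + 1 → |c i| ≤ stabConst M L q * A

theorem abs_le_on_Icc_of_Ioo {f : ℝ → ℝ} {a b A : ℝ} (hf : Continuous f) (hab : a < b)
    (h : ∀ x ∈ Set.Ioo a b, |f x| ≤ A) : ∀ x ∈ Set.Icc a b, |f x| ≤ A := by
  have hcl : IsClosed {x | |f x| ≤ A} := isClosed_le hf.abs continuous_const
  have := closure_minimal (s := Set.Ioo a b) (t := {x | |f x| ≤ A}) h hcl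
  rwa [closure_Ioo hab.ne] at this

/-! ### Degree one as the base of the recursion. -/

section Base

variable {F : Family} {μ : ℝ} {t : ℕ → ℝ} {p : ℕ} {h M : ℝ}

theorem continuous_rise (F : Family) (μ a b : ℝ) : Continuous (rise F μ a b) :=
  (isSection_rise F μ a b).continuous

theorem continuous_fall (F : Family) (μ a b : ℝ) : Continuous (fall F μ a b) :=
  (isSection_fall F μ a b).continuous

theorem rise_left (F : Family) (μ a b : ℝ) : rise F μ a b a = 0 := by
  simp [rise, F.sine_zero]

theorem fall_right (F : Family) (μ a b : ℝ) : fall F μ a b b = 0 := by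
  simp [fall, F.sine_zero]

theorem IsGrid.rise_right (G : IsGrid F μ t p h) {k : ℕ} (hk : t k < t (k + 1)) :
    rise F μ (t k) (t (k + 1)) (t (k + 1)) = 1 :=
  div_self (G.sine_sub_pos le_rfl le_rfl hk).ne'

theorem IsGrid.fall_left (G : IsGrid F μ t p h) {k : ℕ} (hk : t k < t (k + 1)) :
    fall F μ (t k) (t (k + 1)) (t k) = 1 :=
  div_self (G.sine_sub_pos le_rfl le_rfl hk).ne'

theorem basisFun_one_eq_indicator (ht : Monotone t) (i : ℕ) :
    basisFun F μ t 1 i = fun x =>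
      (Set.Ico (t i) (t (i + 1))).indicator (rise F μ (t i) (t (i + 1))) x
      + (Set.Ico (t (i + 1)) (t (i + 2))).indicator (fall F μ (t (i + 1)) (t (i + 2))) x := by
  funext x
  have h1 := ht (show i ≤ i + 1 by omega)
  have h2 := ht (show i + 1 ≤ i + 2 by omega)
  rcases lt_or_ge x (t i) with hx | hx
  · rw [basisFun_one_of_lt ht hx, Set.indicator_of_notMem, Set.indicator_of_notMem, add_zero]
    · rintro ⟨h3, -⟩; linarith
    · rintro ⟨h3, -⟩; linarith
  rcases lt_or_ge x (t (i + 1)) with hx1 | hx1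
  · rw [basisFun_one_rise hx hx1, Set.indicator_of_mem (Set.mem_Ico.2 ⟨hx, hx1⟩),
      Set.indicator_of_notMem, add_zero]
    rintro ⟨h3, -⟩; linarith
  rcases lt_or_ge x (t (i + 2)) with hx2 | hx2
  · rw [basisFun_one_fall hx1 hx2, Set.indicator_of_mem (s := Set.Ico (t (i + 1)) _)
      (Set.mem_Ico.2 ⟨hx1, hx2⟩), Set.indicator_of_notMem, zero_add]
    rintro ⟨-, h3⟩; linarith
  · rw [basisFun_one_of_le ht hx2, Set.indicator_of_notMem, Set.indicator_of_notMem, add_zero]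
    · rintro ⟨-, h3⟩; linarith
    · rintro ⟨-, h3⟩; linarith

theorem intervalIntegrable_indicator_Ico {f : ℝ → ℝ} (hf : Continuous f) (u v a b : ℝ) :
    IntervalIntegrable ((Set.Ico u v).indicator f) MeasureTheory.volume a b :=
  ⟨(hf.intervalIntegrable a b).1.indicator measurableSet_Ico,
    (hf.intervalIntegrable a b).2.indicator measurableSet_Ico⟩

/-- The hat is the product of its two legs, each extended by constants through clamping of the
argument. If a leg degenerates, this happens at an end of `[0,1]`, and on the open interval the
other leg alone remains. -/
theorem IsGrid.continuousOn_basisFun_one (G : IsGrid F μ t p h) (i : ℕ) :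
    ContinuousOn (basisFun F μ t 1 i) (Set.Ioo 0 1) := by
  have h1 := G.monotone (show i ≤ i + 1 by omega)
  have h2 := G.monotone (show i + 1 ≤ i + 2 by omega)
  set A : ℝ → ℝ := fun x => rise F μ (t i) (t (i + 1)) (max (t i) (min (t (i + 1)) x)) with hA
  set B : ℝ → ℝ := fun x =>
    fall F μ (t (i + 1)) (t (i + 2)) (max (t (i + 1)) (min (t (i + 2)) x)) with hB
  have hAc : Continuous A := (continuous_rise _ _ _ _).comp (by fun_prop)
  have hBc : Continuous B := (continuous_fall _ _ _ _).comp (by fun_prop)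
  have A1 : ∀ x, x ≤ t i → A x = 0 := fun x hx => by
    simp only [hA]
    rw [min_eq_right (hx.trans h1), max_eq_left hx, rise_left]
  have A2 : ∀ x, t i ≤ x → x ≤ t (i + 1) → A x = rise F μ (t i) (t (i + 1)) x :=
    fun x hx hx' => by
      simp only [hA]
      rw [min_eq_right hx', max_eq_right hx]
  have A3 : t i < t (i + 1) → ∀ x, t (i + 1) ≤ x → A x = 1 := fun hlt x hx => by
    simp only [hA]
    rw [min_eq_left hx, max_eq_right h1, G.rise_right hlt]
  have B1 : t (i + 1) < t (i + 2) → ∀ x, x ≤ t (i + 1) → B x = 1 := fun hlt x hx => by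
    simp only [hB]
    rw [min_eq_right (hx.trans h2), max_eq_left hx]
    exact G.fall_left hlt
  have B2 : ∀ x, t (i + 1) ≤ x → x ≤ t (i + 2) → B x = fall F μ (t (i + 1)) (t (i + 2)) x :=
    fun x hx hx' => by
      simp only [hB]
      rw [min_eq_right hx', max_eq_right hx]
  have B3 : ∀ x, t (i + 2) ≤ x → B x = 0 := fun x hx => by
    simp only [hB]
    rw [min_eq_left hx, max_eq_right h2, fall_right]
  rcases h1.lt_or_eq with h1' | h1'
  · rcases h2.lt_or_eq with h2' | h2'
    · refine (hAc.mul hBc).continuousOn.congr fun x _ => ?_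
      change _ = A x * B x
      rcases lt_or_ge x (t i) with hx | hx
      · rw [basisFun_one_of_lt G.monotone hx, A1 x hx.le, zero_mul]
      rcases lt_or_ge x (t (i + 1)) with hx1 | hx1
      · rw [basisFun_one_rise hx hx1, A2 x hx hx1.le, B1 h2' x hx1.le, mul_one]
      rcases lt_or_ge x (t (i + 2)) with hx2 | hx2
      · rw [basisFun_one_fall hx1 hx2, A3 h1' x hx1, B2 x hx1 hx2.le, one_mul]
      · rw [basisFun_one_of_le G.monotone hx2, B3 x hx2, mul_zero]
    · have h3 : t (i + 1) = 1 := by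
        rcases G.eq_zero_or_one (i := i + 1) (q := 0) h2' with h4 | h4
        · have h4 : t (i + 2) = 0 := h4
          linarith [G.nonneg i]
        · exact h4
      refine hAc.continuousOn.congr fun x hx => ?_
      rcases lt_or_ge x (t i) with hx' | hx'
      · rw [basisFun_one_of_lt G.monotone hx', A1 x hx'.le]
      · rw [basisFun_one_rise hx' (by rw [h3]; exact hx.2), A2 x hx' (by rw [h3]; exact hx.2.le)]
  · rcases h2.lt_or_eq with h2' | h2'
    · have h3 : t (i + 1) = 0 := by
        rcases G.eq_zero_or_one (i := i) (q := 0) h1' with h4 | h4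
        · exact h4
        · linarith [G.le_one (i + 2)]
      refine hBc.continuousOn.congr fun x hx => ?_
      rcases lt_or_ge x (t (i + 2)) with hx' | hx'
      · rw [basisFun_one_fall (by rw [h3]; exact hx.1.le) hx',
          B2 x (by rw [h3]; exact hx.1.le) hx'.le]
      · rw [basisFun_one_of_le G.monotone hx', B3 x hx']
    · refine (continuous_const (y := (0 : ℝ))).continuousOn.congr fun x _ => ?_
      rcases lt_or_ge x (t i) with hx' | hx'
      · exact basisFun_one_of_lt G.monotone hx'
      · exact basisFun_one_of_le G.monotone (by rw [← h2', ← h1']; exact hx')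

theorem IsGrid.splineFacts_zero (G : IsGrid F μ t p h) (hM : 0 ≤ M)
    (hle : ∀ y, 0 ≤ y → y ≤ h → F.sine (μ * y) ≤ M * F.sine (μ * h)) (L : ℝ) :
    SplineFacts F μ t M L 0 where
  integrable i a b := by
    rw [zero_add, basisFun_one_eq_indicator G.monotone]
    exact (intervalIntegrable_indicator_Ico (continuous_rise _ _ _ _) _ _ _ _).add
      (intervalIntegrable_indicator_Ico (continuous_fall _ _ _ _) _ _ _ _)
  continuousOn i := G.continuousOn_basisFun_one i
  left i x _ hx := basisFun_one_of_lt G.monotone hx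
  right i x _ hx := basisFun_one_of_le G.monotone hx
  nonneg i x _ := by
    rw [zero_add, basisFun_one_eq_indicator G.monotone]
    refine add_nonneg (Set.indicator_nonneg (fun _ hx => ?_) x)
      (Set.indicator_nonneg (fun _ hx => ?_) x)
    · exact G.rise_nonneg hx.1 hx.2.le
    · exact G.fall_nonneg hx.1 hx.2.le
  le i x _ := by
    rw [zero_add]
    rcases lt_or_ge x (t i) with hx | hx
    · rwa [basisFun_one_of_lt G.monotone hx]
    rcases lt_or_ge x (t (i + 1)) with hx1 | hx1
    · have hlt := hx.trans_lt hx1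
      rw [basisFun_one_rise hx hx1, rise, div_le_iff₀ (G.sine_sub_pos le_rfl le_rfl hlt),
        G.step i hlt]
      exact hle _ (by linarith) (by linarith [G.step i hlt])
    rcases lt_or_ge x (t (i + 2)) with hx2 | hx2
    · have hlt := hx1.trans_lt hx2
      have hs : t (i + 2) - t (i + 1) = h := G.step (i + 1) hlt
      rw [basisFun_one_fall hx1 hx2, fall, div_le_iff₀ (G.sine_sub_pos le_rfl le_rfl hlt), hs]
      exact hle _ (by linarith) (by linarith)
    · rwa [basisFun_one_of_le G.monotone hx2]
  piece i m _ := by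
    rcases lt_trichotomy i m with hi | rfl | hi
    · rcases Nat.lt_or_ge (i + 1) m with hi' | hi'
      · exact ⟨_, IsSection.zero _ _, fun x hx => basisFun_one_of_le G.monotone
          ((G.monotone (show i + 2 ≤ m by omega)).trans hx.1.le)⟩
      · obtain rfl : m = i + 1 := by omega
        exact ⟨_, isSection_fall F μ _ _, fun x hx => basisFun_one_fall hx.1.le hx.2⟩
    · exact ⟨_, isSection_rise F μ _ _, fun x hx => basisFun_one_rise hx.1.le hx.2⟩
    · exact ⟨_, IsSection.zero _ _, fun x hx => basisFun_one_of_lt G.monotone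
          (hx.2.trans_le (G.monotone (show m + 1 ≤ i by omega)))⟩
  bound := G.alternationBound_one
  oriented := G.alternationOriented_one
  -- At either end of the knot interval one of `fall`, `rise` equals `1` and the other `0`, so the
  -- two active coefficients are boundary values of the sum. This gives the constant `1`.
  stable m K hm hmK c A hA i hi him := by
    obtain ⟨k, rfl⟩ := Nat.exists_eq_add_of_le' (show 1 ≤ m by have := G.lt_index hm; omega)
    have hA' : ∀ x ∈ Set.Ioo (t (k + 1)) (t (k + 1 + 1)),
        |c k * fall F μ (t (k + 1)) (t (k + 1 + 1)) x
          + c (k + 1) * rise F μ (t (k + 1)) (t (k + 1 + 1)) x| ≤ A := by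
      intro x hx
      have := sum_basisFun_one (F := F) (μ := μ) G.monotone hx.1.le hx.2 (c := c) (b := K)
        (by intro j h1 h2; omega)
      rw [show k + 1 + 1 = k + 2 from rfl, ← this]
      exact hA x hx
    have hcl := abs_le_on_Icc_of_Ioo (((continuous_fall _ _ _ _).const_mul (c k)).add
      ((continuous_rise _ _ _ _).const_mul (c (k + 1)))) hm hA'
    rw [stabConst, one_mul]
    rcases Nat.lt_or_ge i (k + 1) with hi' | hi'
    · obtain rfl : i = k := by omega
      have := hcl _ (Set.left_mem_Icc.2 hm.le)
      rwa [Pi.add_apply, G.fall_left hm, rise_left, mul_one, mul_zero, add_zero] at this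
    · obtain rfl : i = k + 1 := by omega
      have := hcl _ (Set.right_mem_Icc.2 hm.le)
      rwa [Pi.add_apply, G.rise_right hm, fall_right, mul_one, mul_zero, zero_add] at this

end Base

/-! ### Normalized primitives -/

section

/-- The integral over `[0,1]` of the `i`-th spline of degree `q + 1`. -/
def mass (F : Family) (μ : ℝ) (t : ℕ → ℝ) (q i : ℕ) : ℝ :=
  ∫ x in (0 : ℝ)..1, basisFun F μ t (q + 1) i x

/-- The normalized primitive of the `i`-th spline of degree `q + 1`, made continuous on `[0,1]`. -/
def primitive (F : Family) (μ : ℝ) (t : ℕ → ℝ) (q i : ℕ) (x : ℝ) : ℝ :=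
  (if t (i + q + 2) = 0 then 1 else 0)
    + (∫ s in (0 : ℝ)..x, basisFun F μ t (q + 1) i s) / mass F μ t q i

variable {F : Family} {μ : ℝ} {t : ℕ → ℝ} {p : ℕ} {h M L : ℝ} {q : ℕ}

theorem intervalIntegral_eq_zero_of_Ioo {f : ℝ → ℝ} {a b : ℝ} (hab : a ≤ b)
    (hf : ∀ x ∈ Set.Ioo a b, f x = 0) : ∫ x in a..b, f x = 0 := by
  rw [intervalIntegral.integral_of_le hab, MeasureTheory.integral_Ioc_eq_integral_Ioo]
  exact MeasureTheory.setIntegral_eq_zero_of_forall_eq_zero hf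

theorem intervalIntegral_nonneg_of_Ioo {f : ℝ → ℝ} {a b : ℝ} (hab : a ≤ b)
    (hf : ∀ x ∈ Set.Ioo a b, 0 ≤ f x) : 0 ≤ ∫ x in a..b, f x := by
  rw [intervalIntegral.integral_of_le hab, MeasureTheory.integral_Ioc_eq_integral_Ioo]
  exact MeasureTheory.setIntegral_nonneg measurableSet_Ioo hf

namespace SplineFacts

theorem integral_eq_zero (H : SplineFacts F μ t M L q) {i : ℕ} {x : ℝ} (h0 : 0 ≤ x)
    (h1 : x ≤ 1) (hx : x ≤ t i) : ∫ s in (0 : ℝ)..x, basisFun F μ t (q + 1) i s = 0 :=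
  intervalIntegral_eq_zero_of_Ioo h0 fun y hy =>
    H.left i y ⟨hy.1, hy.2.trans_le h1⟩ (hy.2.trans_le hx)

theorem integral_eq_mass (H : SplineFacts F μ t M L q) {i : ℕ} {x : ℝ} (h0 : 0 ≤ x)
    (h1 : x ≤ 1) (hx : t (i + q + 2) ≤ x) :
    ∫ s in (0 : ℝ)..x, basisFun F μ t (q + 1) i s = mass F μ t q i := by
  rw [mass, ← intervalIntegral.integral_add_adjacent_intervals
    (H.integrable i 0 x) (H.integrable i x 1), intervalIntegral_eq_zero_of_Ioo h1, add_zero]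
  exact fun y hy => H.right i y ⟨h0.trans_lt hy.1, hy.2⟩ (hx.trans hy.1.le)

theorem integral_nonneg (H : SplineFacts F μ t M L q) (i : ℕ) {x y : ℝ} (h0 : 0 ≤ x)
    (hxy : x ≤ y) (h1 : y ≤ 1) : 0 ≤ ∫ s in x..y, basisFun F μ t (q + 1) i s :=
  intervalIntegral_nonneg_of_Ioo hxy fun z hz =>
    H.nonneg i z ⟨h0.trans_lt hz.1, hz.2.trans_le h1⟩

theorem mass_nonneg (H : SplineFacts F μ t M L q) (i : ℕ) : 0 ≤ mass F μ t q i :=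
  H.integral_nonneg i le_rfl zero_le_one le_rfl

theorem mass_eq_zero (H : SplineFacts F μ t M L q) {i : ℕ}
    (hi : t (i + q + 2) = 0 ∨ t i = 1) : mass F μ t q i = 0 := by
  rcases hi with hi | hi
  · rw [← H.integral_eq_mass le_rfl zero_le_one hi.le, intervalIntegral.integral_same]
  · exact H.integral_eq_zero zero_le_one le_rfl hi.ge

/-- Local stability with `A = 0` shows that the spline cannot vanish on a nondegenerate knot
interval of its support; nonnegativity and continuity then make the integral positive. -/
theorem mass_pos (H : SplineFacts F μ t M L q) (G : IsGrid F μ t p h) {i : ℕ}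
    (hi : t i < t (i + q + 2)) : 0 < mass F μ t q i := by
  obtain ⟨m, him, hmi, hm⟩ : ∃ m, i ≤ m ∧ m ≤ i + q + 1 ∧ t m < t (m + 1) := by
    by_contra! hcon
    have : ∀ k, k ≤ q + 2 → t (i + k) ≤ t i := by
      intro k
      induction k with
      | zero => simp
      | succ k ih =>
        intro hk
        exact (hcon (i + k) (by omega) (by omega)).trans (ih (by omega))
    exact absurd hi (not_lt.2 (this (q + 2) le_rfl))
  have hsub : Set.Ioo (t m) (t (m + 1)) ⊆ Set.Ioo 0 1 :=
    Set.Ioo_subset_Ioo (G.nonneg m) (G.le_one _)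
  obtain ⟨x, hx, hx0⟩ : ∃ x ∈ Set.Ioo (t m) (t (m + 1)), basisFun F μ t (q + 1) i x ≠ 0 := by
    by_contra! hcon
    have := H.stable m (m + 1) hm (by omega) (fun j => if j = i then 1 else 0) 0
      (fun x hx => by
        rw [Finset.sum_eq_zero]
        · simp
        · intro j _
          split_ifs with hj
          · rw [hj, hcon x hx, mul_zero]
          · rw [zero_mul]) i him hmi
    simp at this
    linarith
  have hxpos : 0 < basisFun F μ t (q + 1) i x :=
    lt_of_le_of_ne (H.nonneg i x (hsub hx)) hx0.symm
  have hx01 := hsub hx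
  have hcont : ContinuousAt (basisFun F μ t (q + 1) i) x :=
    (H.continuousOn i).continuousAt (isOpen_Ioo.mem_nhds hx01)
  have hev := (hcont.eventually (lt_mem_nhds (half_lt_self hxpos))).and
    (isOpen_Ioo.mem_nhds hx01)
  obtain ⟨ε, hε, hball⟩ := Metric.eventually_nhds_iff.1 hev
  have hmem : ∀ y ∈ Set.Icc (x - ε / 2) (x + ε / 2),
      basisFun F μ t (q + 1) i x / 2 < basisFun F μ t (q + 1) i y ∧ y ∈ Set.Ioo (0 : ℝ) 1 := by
    intro y hy
    refine hball ?_
    rw [Real.dist_eq, abs_lt]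
    constructor <;> linarith [hy.1, hy.2]
  have hl := (hmem (x - ε / 2) ⟨le_rfl, by linarith⟩).2
  have hr := (hmem (x + ε / 2) ⟨by linarith, le_rfl⟩).2
  have hmid : 0 < ∫ s in (x - ε / 2)..(x + ε / 2), basisFun F μ t (q + 1) i s := by
    refine intervalIntegral.intervalIntegral_pos_of_pos_on (H.integrable i _ _) ?_ (by linarith)
    intro y hy
    linarith [(hmem y ⟨hy.1.le, hy.2.le⟩).1]
  have e1 := intervalIntegral.integral_add_adjacent_intervals
    (H.integrable i 0 (x - ε / 2)) (H.integrable i (x - ε / 2) (x + ε / 2))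
  have e2 := intervalIntegral.integral_add_adjacent_intervals
    (H.integrable i 0 (x + ε / 2)) (H.integrable i (x + ε / 2) 1)
  have n1 := H.integral_nonneg i le_rfl hl.1.le hl.2.le
  have n2 := H.integral_nonneg i hr.1.le hr.2.le le_rfl
  rw [mass]
  linarith

/-- The support has length at most `(q + 2) h`. The factor `h` is what compensates the `1/h` of the
Markov inequality. -/
theorem mass_le (H : SplineFacts F μ t M L q) (G : IsGrid F μ t p h) (hM : 0 ≤ M) (i : ℕ) :
    mass F μ t q i ≤ (q + 2) * h * M := by
  have hti := G.monotone (show i ≤ i + q + 2 by omega)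
  have e1 := intervalIntegral.integral_add_adjacent_intervals
    (H.integrable i 0 (t i)) (H.integrable i (t i) (t (i + q + 2)))
  rw [H.integral_eq_zero (G.nonneg i) (G.le_one i) le_rfl,
    H.integral_eq_mass (G.nonneg _) (G.le_one _) le_rfl, zero_add] at e1
  have h2 : ‖∫ s in t i..t (i + q + 2), basisFun F μ t (q + 1) i s‖
      ≤ M * |t (i + q + 2) - t i| := by
    refine intervalIntegral.norm_integral_le_of_norm_le_const_ae ?_
    -- The right end of the support may be `1`, where the bounds are not available; it is a null
    -- set.
    have hne : ∀ᵐ x : ℝ, x ≠ t (i + q + 2) := by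
      simp [MeasureTheory.ae_iff, MeasureTheory.measure_singleton]
    filter_upwards [hne] with x hxne hx
    rw [Set.uIoc_of_le hti] at hx
    have hx01 : x ∈ Set.Ioo (0 : ℝ) 1 :=
      ⟨(G.nonneg i).trans_lt hx.1, (lt_of_le_of_ne hx.2 hxne).trans_le (G.le_one _)⟩
    rw [Real.norm_eq_abs, abs_of_nonneg (H.nonneg i x hx01)]
    exact H.le i x hx01
  rw [e1, abs_of_nonneg (by linarith)] at h2
  have h3 := G.le_add_mul i (q + 2)
  push_cast at h3
  rw [← add_assoc] at h3
  calc mass F μ t q i ≤ M * (t (i + q + 2) - t i) := (le_abs_self _).trans h2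
    _ ≤ M * ((q + 2) * h) := by gcongr; linarith
    _ = (q + 2) * h * M := by ring

theorem primitive_zero (i : ℕ) :
    primitive F μ t q i 0 = if t (i + q + 2) = 0 then 1 else 0 := by
  simp [primitive]

theorem primitive_eq_zero (H : SplineFacts F μ t M L q) (G : IsGrid F μ t p h)
    {i : ℕ} {x : ℝ} (h0 : 0 < x) (h1 : x ≤ 1) (hx : x ≤ t i) : primitive F μ t q i x = 0 := by
  have := G.monotone (show i ≤ i + q + 2 by omega)
  rw [primitive, if_neg (by linarith), H.integral_eq_zero h0.le h1 hx]
  simp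

theorem primitive_eq_one (H : SplineFacts F μ t M L q) (G : IsGrid F μ t p h)
    {i : ℕ} {x : ℝ} (h0 : 0 ≤ x) (h1 : x ≤ 1) (hi : t i < 1) (hx : t (i + q + 2) ≤ x) :
    primitive F μ t q i x = 1 := by
  rw [primitive, H.integral_eq_mass h0 h1 hx]
  split_ifs with hz
  · rw [H.mass_eq_zero (Or.inl hz)]
    simp
  · rw [div_self, zero_add]
    refine (H.mass_pos G ?_).ne'
    refine lt_of_le_of_ne (G.monotone (by omega)) fun he => ?_
    rcases G.eq_zero_or_one (q := q + 1) he with h2 | h2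
    · exact hz h2
    · linarith

theorem primitive_one (H : SplineFacts F μ t M L q) (G : IsGrid F μ t p h) (i : ℕ) :
    primitive F μ t q i 1 = if t i < 1 then 1 else 0 := by
  split_ifs with hi
  · exact H.primitive_eq_one G zero_le_one le_rfl hi (G.le_one _)
  · exact H.primitive_eq_zero G zero_lt_one le_rfl (not_lt.1 hi)

theorem primitive_sub (H : SplineFacts F μ t M L q) (i : ℕ) (z y : ℝ) :
    primitive F μ t q i y - primitive F μ t q i z
      = ∫ x in z..y, basisFun F μ t (q + 1) i x / mass F μ t q i := by
  rw [primitive, primitive, intervalIntegral.integral_div,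
    ← intervalIntegral.integral_interval_sub_left (H.integrable i 0 y) (H.integrable i 0 z)]
  ring

theorem primitive_mono (H : SplineFacts F μ t M L q) (i : ℕ) {z y : ℝ} (h0 : 0 ≤ z)
    (hzy : z ≤ y) (h1 : y ≤ 1) : primitive F μ t q i z ≤ primitive F μ t q i y := by
  rw [← sub_nonneg, H.primitive_sub, intervalIntegral.integral_div]
  exact div_nonneg (H.integral_nonneg i h0 hzy h1) (H.mass_nonneg i)

theorem primitive_nonneg (H : SplineFacts F μ t M L q) (i : ℕ) {x : ℝ} (h0 : 0 ≤ x)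
    (h1 : x ≤ 1) : 0 ≤ primitive F μ t q i x := by
  refine le_trans ?_ (H.primitive_mono i le_rfl h0 h1)
  rw [primitive_zero]
  split_ifs <;> norm_num

theorem primitive_le_one (H : SplineFacts F μ t M L q) (G : IsGrid F μ t p h) (i : ℕ) {x : ℝ}
    (h0 : 0 ≤ x) (h1 : x ≤ 1) : primitive F μ t q i x ≤ 1 := by
  refine (H.primitive_mono i h0 h1 le_rfl).trans ?_
  rw [H.primitive_one G]
  split_ifs <;> norm_num

theorem continuous_primitive (H : SplineFacts F μ t M L q) (i : ℕ) :
    Continuous (primitive F μ t q i) :=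
  continuous_const.add
    ((intervalIntegral.continuous_primitive (H.integrable i) 0).div_const _)

theorem hasDerivAt_primitive (H : SplineFacts F μ t M L q) (i : ℕ) {x : ℝ}
    (hx : x ∈ Set.Ioo (0 : ℝ) 1) :
    HasDerivAt (primitive F μ t q i) (basisFun F μ t (q + 1) i x / mass F μ t q i) x := by
  have hc := (H.continuousOn i).continuousAt (isOpen_Ioo.mem_nhds hx)
  have := (intervalIntegral.integral_hasDerivAt_right (H.integrable i 0 x)
    ((H.continuousOn i).stronglyMeasurableAtFilter isOpen_Ioo x hx) hc).div_const
      (mass F μ t q i)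
  exact this.const_add _

/-- On `(0,1)` a unit step at `0` is the constant `1` and one at `1` is the constant `0`. In both
cases the mass is `0`, and division by it contributes `0` to `primitive`. -/
theorem normalizedPrimitive_eq (H : SplineFacts F μ t M L q) (G : IsGrid F μ t p h) (i : ℕ)
    {x : ℝ} (hx : x ∈ Set.Ioo (0 : ℝ) 1) :
    normalizedPrimitive (basisFun F μ t (q + 1) i) (t i) (t (i + q + 2)) x
      = primitive F μ t q i x := by
  rw [normalizedPrimitive]
  split_ifs with he hle
  · refine (H.primitive_eq_one G hx.1.le hx.2.le ?_ hle).symm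
    rw [he]; exact hle.trans_lt hx.2
  · exact (H.primitive_eq_zero G hx.1 hx.2.le (by rw [he]; exact (not_le.1 hle).le)).symm
  · rw [primitive, if_neg, zero_add, mass]
    intro hz
    have := G.monotone (show i ≤ i + q + 2 by omega)
    exact he (by linarith [G.nonneg i])

theorem basisFun_succ (H : SplineFacts F μ t M L q) (G : IsGrid F μ t p h) (i : ℕ)
    {x : ℝ} (hx : x ∈ Set.Ioo (0 : ℝ) 1) :
    basisFun F μ t (q + 2) i x = primitive F μ t q i x - primitive F μ t q (i + 1) x := by
  rw [← H.normalizedPrimitive_eq G i hx, ← H.normalizedPrimitive_eq G (i + 1) hx, basisFun,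
    show i + 1 + q + 2 = i + q + 3 by omega]

end SplineFacts

end

/-! ### The recursion in the degree -/

section

variable {F : Family} {μ : ℝ} {t : ℕ → ℝ} {p : ℕ} {h M L : ℝ} {q : ℕ}

/-- The backward differences of a sequence extended by zero. -/
def backDiff (c : ℕ → ℝ) : ℕ → ℝ
  | 0 => c 0
  | j + 1 => c (j + 1) - c j

/-- Summation by parts; `c b = 0` removes the boundary term. This is why coefficients are later
updated to `0` just beyond the range. -/
theorem sum_mul_sub_succ {c u : ℕ → ℝ} {b : ℕ} (hb : c b = 0) :
    ∑ j ∈ Finset.range b, c j * (u j - u (j + 1))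
      = ∑ j ∈ Finset.range (b + 1), backDiff c j * u j := by
  have key : ∀ b, ∑ j ∈ Finset.range b, c j * (u j - u (j + 1)) + c b * u b
      = ∑ j ∈ Finset.range (b + 1), backDiff c j * u j := by
    intro b
    induction b with
    | zero => simp [backDiff]
    | succ b ih =>
      rw [Finset.sum_range_succ, Finset.sum_range_succ _ (b + 1), ← ih, backDiff]
      ring
  rw [← key, hb, zero_mul, add_zero]

/-- The combination `∑ cⱼ Nⱼ` of splines of degree `q + 2`, made continuous on `[0,1]`. -/
def splineSum (F : Family) (μ : ℝ) (t : ℕ → ℝ) (q : ℕ) (c : ℕ → ℝ) (b : ℕ) (x : ℝ) : ℝ :=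
  ∑ j ∈ Finset.range b, c j * (primitive F μ t q j x - primitive F μ t q (j + 1) x)

/-- The derivative of `splineSum`. -/
def splineSumDeriv (F : Family) (μ : ℝ) (t : ℕ → ℝ) (q : ℕ) (c : ℕ → ℝ) (b : ℕ) (x : ℝ) : ℝ :=
  ∑ j ∈ Finset.range (b + 1), backDiff c j / mass F μ t q j * basisFun F μ t (q + 1) j x

namespace SplineFacts

theorem eqOn_splineSum (H : SplineFacts F μ t M L q) (G : IsGrid F μ t p h) (c : ℕ → ℝ) (b : ℕ) :
    Set.EqOn (fun x => ∑ j ∈ Finset.range b, c j * basisFun F μ t (q + 2) j x)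
      (splineSum F μ t q c b) (Set.Ioo 0 1) :=
  fun _ hx => Finset.sum_congr rfl fun j _ => by rw [H.basisFun_succ G j hx]

theorem splineSum_sub (H : SplineFacts F μ t M L q) {c : ℕ → ℝ} {b : ℕ} (hb : c b = 0)
    (z y : ℝ) :
    splineSum F μ t q c b y - splineSum F μ t q c b z
      = ∫ x in z..y, splineSumDeriv F μ t q c b x := by
  unfold splineSum splineSumDeriv
  rw [sum_mul_sub_succ (u := fun j => primitive F μ t q j y) hb,
    sum_mul_sub_succ (u := fun j => primitive F μ t q j z) hb, ← Finset.sum_sub_distrib,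
    intervalIntegral.integral_finsetSum fun j _ => (H.integrable j z y).const_mul _]
  refine Finset.sum_congr rfl fun j _ => ?_
  rw [← mul_sub, H.primitive_sub, ← intervalIntegral.integral_const_mul]
  congr 1
  funext x
  ring

theorem hasDerivAt_splineSum (H : SplineFacts F μ t M L q) {c : ℕ → ℝ} {b : ℕ} (hb : c b = 0)
    {x : ℝ} (hx : x ∈ Set.Ioo (0 : ℝ) 1) :
    HasDerivAt (splineSum F μ t q c b) (splineSumDeriv F μ t q c b x) x := by
  have e : splineSum F μ t q c b
      = fun x => ∑ j ∈ Finset.range (b + 1), backDiff c j * primitive F μ t q j x :=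
    funext fun x => sum_mul_sub_succ (u := fun j => primitive F μ t q j x) hb
  rw [e]
  refine (HasDerivAt.fun_sum fun j _ =>
    (H.hasDerivAt_primitive j hx).const_mul (backDiff c j)).congr_deriv ?_
  refine Finset.sum_congr rfl fun j _ => ?_
  ring

theorem splineSum_zero (G : IsGrid F μ t p h) {c : ℕ → ℝ} {a b : ℕ}
    (ha : ∀ j < a, c j = 0) (hta : t (a + q + 2) ≠ 0) : splineSum F μ t q c b 0 = 0 := by
  refine Finset.sum_eq_zero fun j _ => ?_
  rcases lt_or_ge j a with hj | hj
  · rw [ha j hj, zero_mul]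
  · have h0 := (G.nonneg (a + q + 2)).lt_of_ne' hta
    have h1 := G.monotone (show a + q + 2 ≤ j + q + 2 by omega)
    have h2 := G.monotone (show a + q + 2 ≤ j + 1 + q + 2 by omega)
    rw [primitive_zero, primitive_zero, if_neg (by linarith), if_neg (by linarith)]
    ring

theorem splineSum_one (H : SplineFacts F μ t M L q) (G : IsGrid F μ t p h) {c : ℕ → ℝ} {b : ℕ}
    (htb : t b < 1) : splineSum F μ t q c b 1 = 0 := by
  refine Finset.sum_eq_zero fun j hj => ?_
  have hj := Finset.mem_range.1 hj
  have h1 := G.monotone (show j ≤ b by omega)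
  have h2 := G.monotone (show j + 1 ≤ b by omega)
  rw [H.primitive_one G, H.primitive_one G, if_pos (by linarith), if_pos (by linarith)]
  ring

theorem splineSum_succ_one (H : SplineFacts F μ t M L q) (G : IsGrid F μ t p h) {c : ℕ → ℝ}
    {b : ℕ} (htb : t b < 1) (htb' : ¬ t (b + 1) < 1) : splineSum F μ t q c (b + 1) 1 = c b := by
  rw [splineSum, Finset.sum_range_succ]
  have := H.splineSum_one G (c := c) htb
  rw [splineSum] at this
  rw [this, H.primitive_one G, H.primitive_one G, if_pos htb, if_neg htb']
  ring

theorem backDiff_div_mass_eq_zero (H : SplineFacts F μ t M L q) {c : ℕ → ℝ} {a k : ℕ}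
    (ha : ∀ j < a, c j = 0) (hk : k = 0 ∧ t (a + q + 2) = 0 ∨ k = 1) :
    ∀ j < a + 1 - k, backDiff c j / mass F μ t q j = 0 := by
  intro j hj
  rcases Nat.lt_or_ge j a with hja | hja
  · have : backDiff c j = 0 := by
      cases j with
      | zero => exact ha 0 hja
      | succ j => rw [backDiff, ha _ hja, ha j (by omega), sub_zero]
    rw [this, zero_div]
  · rcases hk with ⟨rfl, h0⟩ | rfl
    · obtain rfl : j = a := by omega
      rw [H.mass_eq_zero (Or.inl h0), div_zero]
    · omega

theorem splineSumDeriv_eq_of_one (H : SplineFacts F μ t M L q) {c : ℕ → ℝ} {b : ℕ}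
    (htb : t b = 1) : splineSumDeriv F μ t q c b = fun x =>
      ∑ j ∈ Finset.range b, backDiff c j / mass F μ t q j * basisFun F μ t (q + 1) j x := by
  funext x
  rw [splineSumDeriv, Finset.sum_range_succ, H.mass_eq_zero (Or.inr htb)]
  simp

/-- Either the sum vanishes at `0` and Rolle's theorem gains a point (`k = 1`), or the derivative
loses its first term because that spline has degenerate support (`k = 0`). Both the number of points
and the number of terms shift by `k`, so one count serves both cases. -/
theorem exists_left_defect (G : IsGrid F μ t p h) (q : ℕ) {c : ℕ → ℝ} {a : ℕ} (b : ℕ)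
    (ha : ∀ j < a, c j = 0) : ∃ k, (k = 0 ∧ t (a + q + 2) = 0 ∨ k = 1) ∧
      (k = 0 ∨ k = 1 ∧ splineSum F μ t q c b 0 = 0) := by
  by_cases hta : t (a + q + 2) = 0
  · exact ⟨0, Or.inl ⟨rfl, hta⟩, Or.inl rfl⟩
  · exact ⟨1, Or.inr rfl, Or.inr ⟨rfl, splineSum_zero G ha hta⟩⟩

theorem sum_update_eq (c : ℕ → ℝ) (b : ℕ) (u : ℕ → ℝ → ℝ) :
    (fun x => ∑ j ∈ Finset.range b, c j * u j x)
      = fun x => ∑ j ∈ Finset.range b, Function.update c b 0 j * u j x := by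
  funext x
  refine Finset.sum_congr rfl fun j hj => ?_
  rw [Function.update_of_ne (Finset.mem_range.1 hj).ne]

/-- Too many alternations of the sum pass to its derivative by Rolle's theorem. If `t b < 1`, the
zero at `1` adds a point, and `m + 1 + k` terms would alternate `m + 2 + k` times. If `t b = 1`, the
last term of the derivative drops out, and `m + k` terms would alternate `m + 1 + k` times. -/
theorem bound_succ (H : SplineFacts F μ t M L q) (G : IsGrid F μ t p h) :
    AlternationBound (basisFun F μ t (q + 2)) := by
  intro c a m σ ha hl
  cases m with
  | zero =>
    obtain ⟨y, -, -, hy, -⟩ := hl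
    have h0 : ∑ j ∈ Finset.range (a + 0), c j * basisFun F μ t (q + 2) j y = 0 :=
      Finset.sum_eq_zero fun j hj => by rw [ha j (by simpa using hj), zero_mul]
    simp only [h0, mul_zero, lt_irrefl] at hy
  | succ m =>
    rw [sum_update_eq] at hl
    set b := a + (m + 1) with hb
    set c' := Function.update c b 0 with hc'
    have ha' : ∀ j < a, c' j = 0 := fun j hj => by
      rw [hc', Function.update_of_ne (by omega), ha j hj]
    have hcb : c' b = 0 := Function.update_self ..
    replace hl := hl.congr (H.eqOn_splineSum G c' b)
    obtain ⟨k, hk, hk'⟩ := exists_left_defect G q b ha'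
    have hk1 : k ≤ 1 := by omega
    have he := H.backDiff_div_mass_eq_zero ha' hk
    have hF := fun z y (_ : 0 ≤ z) (_ : z ≤ y) (_ : y ≤ 1) => H.splineSum_sub hcb z y
    rcases (G.le_one b).lt_or_eq with htb | htb
    · have hch := hl.of_primitive_right hF hk' (by rw [H.splineSum_one G htb, mul_zero])
      refine H.bound _ (a + 1 - k) (m + 1 + k) (-σ) he ?_
      rwa [show a + 1 - k + (m + 1 + k) = b + 1 by omega]
    · have hch := hl.of_primitive hF hk'
      rw [H.splineSumDeriv_eq_of_one htb] at hch
      refine H.bound _ (a + 1 - k) (m + k) σ he ?_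
      rwa [show a + 1 - k + (m + k) = b by omega, Nat.add_right_comm]

/-- If the sum vanishes at `1`, its derivative is again extremal, with rightmost sign `-σ` and last
coefficient `-c b / mass`, so the two minus signs cancel. -/
theorem oriented_succ (H : SplineFacts F μ t M L q) (G : IsGrid F μ t p h) :
    AlternationOriented (basisFun F μ t (q + 2)) t := by
  intro c a m σ ha ht hl
  rw [sum_update_eq] at hl
  set b := a + m with hb
  set c' := Function.update c (b + 1) 0 with hc'
  have ha' : ∀ j < a, c' j = 0 := fun j hj => by
    rw [hc', Function.update_of_ne (by omega), ha j hj]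
  have hcb : c' (b + 1) = 0 := Function.update_self ..
  have hcc : c b = c' b := by rw [hc', Function.update_of_ne (by omega)]
  rw [hcc]
  replace hl := hl.congr (H.eqOn_splineSum G c' (b + 1))
  obtain ⟨k, hk, hk'⟩ := exists_left_defect G q (b + 1) ha'
  have hk1 : k ≤ 1 := by omega
  have he := H.backDiff_div_mass_eq_zero ha' hk
  have hF := fun z y (_ : 0 ≤ z) (_ : z ≤ y) (_ : y ≤ 1) => H.splineSum_sub hcb z y
  rcases (G.le_one (b + 1)).lt_or_eq with htb | htb
  · have hch := hl.of_primitive_right hF hk' (by rw [H.splineSum_one G htb, mul_zero])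
    have := H.oriented _ (a + 1 - k) (m + k) (-σ) he
      (by rwa [show a + 1 - k + (m + k) = b + 1 by omega])
      (by rwa [show a + 1 - k + (m + k) = b + 1 by omega])
    rw [show a + 1 - k + (m + k) = b + 1 by omega, backDiff, hcb, zero_sub, neg_div,
      neg_mul_neg, ← mul_div_assoc] at this
    exact (div_pos_iff_of_pos_right (lt_of_le_of_ne (H.mass_nonneg _)
      fun h0 => by rw [← h0, div_zero] at this; exact lt_irrefl _ this)).1 this
  -- Here the sum takes the value `c b` at `1`. If this did not have the sign `σ`, the right end
  -- would give the derivative one alternation more than its `m + k` terms allow.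
  · by_contra! hσ
    have hch := hl.of_primitive_right hF hk'
      (by rwa [H.splineSum_succ_one G ht (by rw [htb]; exact lt_irrefl _)])
    rw [H.splineSumDeriv_eq_of_one htb] at hch
    refine H.bound _ (a + 1 - k) (m + k) (-σ) he ?_
    rwa [show a + 1 - k + (m + k) = b + 1 by omega]

theorem left_succ (H : SplineFacts F μ t M L q) (G : IsGrid F μ t p h) (i : ℕ) {x : ℝ}
    (hx : x ∈ Set.Ioo (0 : ℝ) 1) (hi : x ≤ t i) : basisFun F μ t (q + 2) i x = 0 := by
  rw [H.basisFun_succ G i hx, H.primitive_eq_zero G hx.1 hx.2.le hi,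
    H.primitive_eq_zero G hx.1 hx.2.le (hi.trans (G.monotone (by omega))), sub_zero]

theorem right_succ (H : SplineFacts F μ t M L q) (G : IsGrid F μ t p h) (i : ℕ) {x : ℝ}
    (hx : x ∈ Set.Ioo (0 : ℝ) 1) (hi : t (i + q + 3) ≤ x) : basisFun F μ t (q + 2) i x = 0 := by
  have h1 : t (i + q + 2) ≤ x := (G.monotone (by omega)).trans hi
  have h2 : t i ≤ x := (G.monotone (by omega)).trans hi
  have h3 : t (i + 1) ≤ x := (G.monotone (by omega)).trans hi
  rw [H.basisFun_succ G i hx, H.primitive_eq_one G hx.1.le hx.2.le (h2.trans_lt hx.2) h1,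
    H.primitive_eq_one G hx.1.le hx.2.le (h3.trans_lt hx.2)
      (by rwa [show i + 1 + q + 2 = i + q + 3 by omega]), sub_self]

/-- The orientation property for a single term: a negative value would force the coefficient `1` to
be negative. -/
theorem nonneg_succ (H : SplineFacts F μ t M L q) (G : IsGrid F μ t p h) (i : ℕ) {x : ℝ}
    (hx : x ∈ Set.Ioo (0 : ℝ) 1) : 0 ≤ basisFun F μ t (q + 2) i x := by
  by_contra! hneg
  have hti : t i < 1 := by
    by_contra! hcon
    rw [H.left_succ G i hx (hx.2.le.trans hcon)] at hneg
    exact lt_irrefl _ hneg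
  have := H.oriented_succ G (fun j => if j = i then 1 else 0) i 0 (-1)
    (fun j hj => if_neg hj.ne) hti
    ⟨x, hx.1, hx.2, by
      beta_reduce
      rw [Finset.sum_eq_single i (fun j _ hj => by rw [if_neg hj, zero_mul])
        (fun hi => absurd (Finset.mem_range.2 (by omega)) hi), if_pos rfl]
      linarith, trivial⟩
  norm_num at this

theorem le_one_succ (H : SplineFacts F μ t M L q) (G : IsGrid F μ t p h) (i : ℕ) {x : ℝ}
    (hx : x ∈ Set.Ioo (0 : ℝ) 1) : basisFun F μ t (q + 2) i x ≤ 1 := by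
  rw [H.basisFun_succ G i hx]
  linarith [H.primitive_le_one G i hx.1.le hx.2.le, H.primitive_nonneg (i + 1) hx.1.le hx.2.le]

/-- The sum telescopes from the primitive of index `0`, which is `1` because its support is `{0}`,
to that of index `K`, which is still `0` at `x`. -/
theorem sum_basisFun_succ (H : SplineFacts F μ t M L q) (G : IsGrid F μ t p h) (hq : q + 1 ≤ p)
    {K : ℕ} {x : ℝ} (hx : x ∈ Set.Ioo (0 : ℝ) 1) (hK : x ≤ t K) :
    ∑ i ∈ Finset.range K, basisFun F μ t (q + 2) i x = 1 := by
  rw [Finset.sum_congr rfl fun i _ => H.basisFun_succ G i hx,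
    Finset.sum_range_sub' (fun i => primitive F μ t q i x),
    H.primitive_eq_one G hx.1.le hx.2.le (by rw [G.eq_zero 0 (by omega)]; exact zero_lt_one)
      (by rw [G.eq_zero _ (by omega)]; exact hx.1.le),
    H.primitive_eq_zero G hx.1 hx.2.le hK, sub_zero]

theorem integrable_normalizedPrimitive (H : SplineFacts F μ t M L q) (i : ℕ) (a b u v : ℝ) :
    IntervalIntegrable (normalizedPrimitive (basisFun F μ t (q + 1) i) u v)
      MeasureTheory.volume a b := by
  by_cases huv : u = v
  · refine Monotone.intervalIntegrable fun x y hxy => ?_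
    simp only [normalizedPrimitive, if_pos huv]
    split_ifs with h1 h2
    · exact le_rfl
    · exact absurd (h1.trans hxy) h2
    · exact zero_le_one
    · exact le_rfl
  · have e : normalizedPrimitive (basisFun F μ t (q + 1) i) u v = fun x =>
        (∫ s in (0 : ℝ)..x, basisFun F μ t (q + 1) i s) / mass F μ t q i := by
      funext x
      rw [normalizedPrimitive, if_neg huv, mass]
    rw [e]
    exact ((intervalIntegral.continuous_primitive (H.integrable i) 0).div_const _).intervalIntegrable
      _ _

theorem integrable_succ (H : SplineFacts F μ t M L q) (i : ℕ) (a b : ℝ) :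
    IntervalIntegrable (basisFun F μ t (q + 2) i) MeasureTheory.volume a b := by
  have e : basisFun F μ t (q + 2) i = fun x =>
      normalizedPrimitive (basisFun F μ t (q + 1) i) (t i) (t (i + q + 2)) x
        - normalizedPrimitive (basisFun F μ t (q + 1) (i + 1)) (t (i + 1)) (t (i + q + 3)) x := by
    funext x
    rw [basisFun]
  rw [e]
  exact (H.integrable_normalizedPrimitive i a b _ _).sub
    (H.integrable_normalizedPrimitive (i + 1) a b _ _)

theorem continuousOn_succ (H : SplineFacts F μ t M L q) (G : IsGrid F μ t p h) (i : ℕ) :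
    ContinuousOn (basisFun F μ t (q + 2) i) (Set.Ioo 0 1) :=
  ((H.continuous_primitive i).sub (H.continuous_primitive (i + 1))).continuousOn.congr
    fun _ hx => H.basisFun_succ G i hx

theorem piece_primitive (H : SplineFacts F μ t M L q) (i : ℕ) {m : ℕ}
    (hm : t m < t (m + 1)) : ∃ f, IsSection (F.sign * μ ^ 2) (q + 1) f ∧
      Set.EqOn (primitive F μ t q i) f (Set.Ioo (t m) (t (m + 1))) := by
  obtain ⟨f, hf, hfe⟩ := H.piece i m hm
  refine ⟨fun x => primitive F μ t q i (t m) + (mass F μ t q i)⁻¹ * ∫ s in t m..x, f s,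
    ⟨fun x => (mass F μ t q i)⁻¹ * f x, hf.const_mul _, fun x => ?_⟩, fun x hx => ?_⟩
  · have := intervalIntegral.integral_hasDerivAt_right
      (hf.continuous.intervalIntegrable (t m) x)
      hf.continuous.stronglyMeasurable.stronglyMeasurableAtFilter hf.continuous.continuousAt
    exact (this.const_mul _).const_add _
  · have h1 := H.primitive_sub i (t m) x
    have h2 : ∫ s in t m..x, basisFun F μ t (q + 1) i s = ∫ s in t m..x, f s := by
      rw [intervalIntegral.integral_of_le hx.1.le, intervalIntegral.integral_of_le hx.1.le]
      exact MeasureTheory.setIntegral_congr_fun measurableSet_Ioc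
        fun s hs => hfe ⟨hs.1, hs.2.trans_lt hx.2⟩
    rw [intervalIntegral.integral_div, h2] at h1
    change _ = primitive F μ t q i (t m) + (mass F μ t q i)⁻¹ * ∫ s in t m..x, f s
    rw [← div_eq_inv_mul]
    linarith

theorem piece_succ (H : SplineFacts F μ t M L q) (G : IsGrid F μ t p h) (i m : ℕ)
    (hm : t m < t (m + 1)) : ∃ f, IsSection (F.sign * μ ^ 2) (q + 1) f ∧
      Set.EqOn (basisFun F μ t (q + 2) i) f (Set.Ioo (t m) (t (m + 1))) := by
  obtain ⟨f, hf, hfe⟩ := H.piece_primitive i hm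
  obtain ⟨g, hg, hge⟩ := H.piece_primitive (i + 1) hm
  refine ⟨_, hf.add (hg.const_mul (-1)), fun x hx => ?_⟩
  rw [H.basisFun_succ G i ⟨(G.nonneg m).trans_lt hx.1, hx.2.trans_le (G.le_one _)⟩, hfe hx, hge hx]
  ring

/-- The Markov inequality and stability in the lower degree bound the differences of active
coefficients by `E`. All of them are then within `(q + 2) E` of `c m`, which the partition of unity
controls. -/
theorem stable_succ (H : SplineFacts F μ t M L q) (G : IsGrid F μ t p h) (hq : q + 2 ≤ p)
    (hM : 0 ≤ M) (hL : |F.sign * μ ^ 2| * h ^ 2 ≤ L) (m K : ℕ) (hm : t m < t (m + 1))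
    (hmK : m < K) (c : ℕ → ℝ) (A : ℝ)
    (hA : ∀ x ∈ Set.Ioo (t m) (t (m + 1)),
      |∑ i ∈ Finset.range K, c i * basisFun F μ t (q + 2) i x| ≤ A)
    (i : ℕ) (hi : i ≤ m) (him : m ≤ i + (q + 1) + 1) : |c i| ≤ stabConst M L (q + 1) * A := by
  have hsub : Set.Ioo (t m) (t (m + 1)) ⊆ Set.Ioo 0 1 :=
    Set.Ioo_subset_Ioo (G.nonneg m) (G.le_one _)
  have hstep := G.step m hm
  have hh := G.pos
  have hpm := G.lt_index hm
  obtain ⟨x₀, hx₀⟩ : (Set.Ioo (t m) (t (m + 1))).Nonempty := Set.nonempty_Ioo.2 hm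
  have hA0 : 0 ≤ A := (abs_nonneg _).trans (hA x₀ hx₀)
  set c' := Function.update c K 0 with hc'
  have hcc : ∀ j, j < K → c j = c' j := fun j hj => by
    rw [hc', Function.update_of_ne hj.ne]
  have hcK : c' K = 0 := Function.update_self ..
  rw [hcc i (by omega)]
  have hA' : ∀ x ∈ Set.Ioo (t m) (t (m + 1)),
      |∑ i ∈ Finset.range K, c' i * basisFun F μ t (q + 2) i x| ≤ A := by
    intro x hx
    rw [← Finset.sum_congr rfl fun j hj => by rw [← hcc j (Finset.mem_range.1 hj)]]
    exact hA x hx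
  choose f hf hfe using fun i => H.piece_succ G i m hm
  have hsec := IsSection.sum (Finset.range K) c' fun j _ => hf j
  have hse : Set.EqOn (splineSum F μ t q c' K)
      (fun x => ∑ j ∈ Finset.range K, c' j * f j x) (Set.Ioo (t m) (t (m + 1))) := by
    intro x hx
    rw [← H.eqOn_splineSum G c' K (hsub hx)]
    exact Finset.sum_congr rfl fun j _ => by rw [hfe j hx]
  have hsA := abs_le_on_Icc_of_Ioo hsec.continuous hm (A := A) fun x hx => by
    change |(fun x => ∑ j ∈ Finset.range K, c' j * f j x) x| ≤ A
    rw [← hse hx, ← H.eqOn_splineSum G c' K (hsub hx)]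
    exact hA' x hx
  obtain ⟨g, hg, hgd⟩ := id hsec
  have hb : t (m + 1) = t m + h := by linarith
  have hmark := hsec.abs_deriv_le hh hL hgd (by rwa [← hb])
  have hder : ∀ x ∈ Set.Ioo (t m) (t (m + 1)), |∑ j ∈ Finset.range (K + 1),
      backDiff c' j / mass F μ t q j * basisFun F μ t (q + 1) j x|
        ≤ markovConst L (q + 1) / h * A := by
    intro x hx
    have h1 := H.hasDerivAt_splineSum hcK (hsub hx)
    have h2 := (hgd x).congr_of_eventuallyEq (hse.eventuallyEq_of_mem (isOpen_Ioo.mem_nhds hx))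
    have h3 := h1.unique h2
    rw [splineSumDeriv] at h3
    rw [h3]
    exact hmark x ⟨hx.1.le, by rw [← hb]; exact hx.2.le⟩
  set D := stabConst M L q with hD
  set B := markovConst L (q + 1) with hB
  set E := (q + 2) * M * (D * B) * A with hE
  have hdiff : ∀ j, j ≤ m → m ≤ j + q + 1 → |backDiff c' j| ≤ E := by
    intro j hj hjm
    have h1 := H.stable m (K + 1) hm (by omega) _ _ hder j hj hjm
    have hw : 0 < mass F μ t q j := H.mass_pos G
      ((G.monotone hj).trans_lt (hm.trans_le (G.monotone (by omega))))
    rw [abs_div, abs_of_pos hw, div_le_iff₀ hw] at h1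
    have hnn : 0 ≤ D * (B / h * A) := nonneg_of_mul_nonneg_left
      ((abs_nonneg _).trans h1) hw
    -- The factor `h` in the bound for the mass cancels the `1/h` of the Markov inequality, so `E`
    -- is free of `h`.
    refine h1.trans ((mul_le_mul_of_nonneg_left (H.mass_le G hM j) hnn).trans_eq ?_)
    rw [hE]
    field_simp
  have hE0 : 0 ≤ E := (abs_nonneg _).trans (hdiff m le_rfl (by omega))
  have hdist : ∀ k, k ≤ q + 2 → |c' (m - k) - c' m| ≤ k * E := by
    intro k
    induction k with
    | zero => simp
    | succ k ih =>
      intro hk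
      have h1 := ih (by omega)
      have h2 := hdiff (m - k) (by omega) (by omega)
      rw [show m - k = m - (k + 1) + 1 by omega, backDiff, abs_sub_comm] at h2
      rw [show m - k = m - (k + 1) + 1 by omega] at h1
      have h3 := abs_sub_le (c' (m - (k + 1))) (c' (m - (k + 1) + 1)) (c' m)
      push_cast
      linarith
  have hdist' : ∀ j, j ≤ m → m ≤ j + q + 2 → |c' j - c' m| ≤ (q + 2) * E := by
    intro j hj hjm
    have := hdist (m - j) (by omega)
    rw [show m - (m - j) = j by omega] at this
    refine this.trans ?_
    gcongr
    have : ((m - j : ℕ) : ℝ) ≤ ((q + 2 : ℕ) : ℝ) := by exact_mod_cast (by omega)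
    simpa using this
  have hx01 := hsub hx₀
  have hpu := H.sum_basisFun_succ G (by omega) hx01
    (hx₀.2.le.trans (G.monotone (show m + 1 ≤ K by omega)))
  have hcm : |c' m| ≤ A + (q + 2) * E := by
    -- By the partition of unity, `c' m` is the value of the sum at `x₀` minus a convex combination
    -- of the deviations `c' j - c' m`.
    have e : c' m = ∑ j ∈ Finset.range K, c' j * basisFun F μ t (q + 2) j x₀
        - ∑ j ∈ Finset.range K, (c' j - c' m) * basisFun F μ t (q + 2) j x₀ := by
      simp only [sub_mul, Finset.sum_sub_distrib, ← Finset.mul_sum, hpu]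
      ring
    have h1 : |∑ j ∈ Finset.range K, (c' j - c' m) * basisFun F μ t (q + 2) j x₀|
        ≤ (q + 2) * E := by
      refine (Finset.abs_sum_le_sum_abs _ _).trans ?_
      have : ∀ j ∈ Finset.range K, |(c' j - c' m) * basisFun F μ t (q + 2) j x₀|
          ≤ (q + 2) * E * basisFun F μ t (q + 2) j x₀ := by
        intro j _
        rw [abs_mul, abs_of_nonneg (H.nonneg_succ G j hx01)]
        rcases Nat.lt_or_ge m j with h1 | h1
        · rw [H.left_succ G j hx01 (hx₀.2.le.trans (G.monotone h1))]
          simp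
        rcases Nat.lt_or_ge (j + q + 2) m with h2 | h2
        · rw [H.right_succ G j hx01 ((G.monotone (by omega)).trans hx₀.1.le)]
          simp
        exact mul_le_mul_of_nonneg_right (hdist' j h1 h2) (H.nonneg_succ G j hx01)
      refine (Finset.sum_le_sum this).trans_eq ?_
      rw [← Finset.mul_sum, hpu, mul_one]
    have h2 := hA' x₀ hx₀
    rw [e]
    exact (abs_sub _ _).trans (add_le_add h2 h1)
  have hfin := hdist' i hi him
  have h4 := abs_sub_abs_le_abs_sub (c' i) (c' m)
  rw [stabConst, ← hD, ← hB]
  have e : (1 + 2 * ((q : ℝ) + 2) * ((q + 2) * M * (D * B))) * A = A + 2 * ((q + 2) * E) := by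
    rw [hE]; ring
  rw [e]
  linarith

theorem succ (H : SplineFacts F μ t M L q) (G : IsGrid F μ t p h) (hq : q + 2 ≤ p)
    (hM : 1 ≤ M) (hL : |F.sign * μ ^ 2| * h ^ 2 ≤ L) : SplineFacts F μ t M L (q + 1) where
  integrable := H.integrable_succ
  continuousOn := H.continuousOn_succ G
  left i _ hx hi := H.left_succ G i hx hi.le
  right i _ hx hi := H.right_succ G i hx hi
  nonneg i _ hx := H.nonneg_succ G i hx
  le i _ hx := (H.le_one_succ G i hx).trans hM
  piece := H.piece_succ G
  bound := H.bound_succ G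
  oriented := H.oriented_succ G
  stable := H.stable_succ G hq (by linarith) hL

end SplineFacts

theorem IsGrid.splineFacts (G : IsGrid F μ t p h) (hM : 1 ≤ M)
    (hle : ∀ y, 0 ≤ y → y ≤ h → F.sine (μ * y) ≤ M * F.sine (μ * h))
    (hL : |F.sign * μ ^ 2| * h ^ 2 ≤ L) : ∀ {q : ℕ}, q + 1 ≤ p → SplineFacts F μ t M L q
  | 0, _ => G.splineFacts_zero (by linarith) hle L
  | q + 1, hq => (G.splineFacts hM hle hL (q := q) (by omega)).succ G hq hM hL

end

/-! ### The open uniform knots -/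

theorem knot_eq_zero {n p i : ℕ} (hi : i ≤ p + 1) : knot n p i = 0 := by
  rw [knot, max_eq_left]
  refine (min_le_right _ _).trans (div_nonpos_of_nonpos_of_nonneg ?_ (Nat.cast_nonneg n))
  have : (i : ℝ) ≤ p + 1 := by exact_mod_cast hi
  linarith

theorem knot_eq_one {n p i : ℕ} (hn : 0 < n) (hi : p + 1 + n ≤ i) : knot n p i = 1 := by
  have hn' : (0 : ℝ) < n := by exact_mod_cast hn
  have : ((p : ℝ) + 1 + n) ≤ i := by exact_mod_cast hi
  rw [knot, min_eq_left, max_eq_right zero_le_one]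
  rw [le_div_iff₀ hn']
  linarith

theorem knot_add {n p k : ℕ} (hn : 0 < n) (hk : k ≤ n) : knot n p (p + 1 + k) = k / n := by
  have hn' : (0 : ℝ) < n := by exact_mod_cast hn
  have hk' : (k : ℝ) ≤ n := by exact_mod_cast hk
  rw [knot]
  push_cast
  rw [add_sub_cancel_left, min_eq_right ((div_le_one hn').2 hk'), max_eq_right (by positivity)]

theorem knot_monotone (n p : ℕ) : Monotone (knot n p) := by
  intro i j hij
  have : (i : ℝ) ≤ j := by exact_mod_cast hij
  unfold knot
  gcongr

theorem Family.sine_pos_of_admissible {F : Family} {μ : ℝ} {n : ℕ} (hn : 0 < n)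
    (hF : F.Admissible μ n) {x : ℝ} (hx : 0 < x) (hxn : x ≤ 1 / n) : 0 < F.sine (μ * x) := by
  have hn' : (0 : ℝ) < n := by exact_mod_cast hn
  cases F with
  | hyperbolic => exact Real.sinh_pos_iff.2 (mul_pos hF hx)
  | trigonometric =>
    refine Real.sin_pos_of_pos_of_lt_pi (mul_pos hF.1 hx) ?_
    calc μ * x ≤ μ * (1 / n) := by gcongr; exact hF.1.le
      _ < n * Real.pi * (1 / n) := by gcongr; exact hF.2
      _ = Real.pi := by field_simp

theorem isGrid_knot {F : Family} {μ : ℝ} {n : ℕ} (p : ℕ) (hn : 0 < n)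
    (hF : F.Admissible μ n) : IsGrid F μ (knot n p) p (1 / n) where
  monotone := knot_monotone n p
  eq_zero _ hi := knot_eq_zero hi
  le_one i := max_le zero_le_one (min_le_left _ _)
  exists_eq_one := ⟨p + 1 + n, knot_eq_one hn le_rfl⟩
  step i hi := by
    obtain ⟨k, rfl⟩ : ∃ k, i = p + 1 + k := by
      refine Nat.exists_eq_add_of_le ?_
      by_contra! hlt
      rw [knot_eq_zero (by omega), knot_eq_zero (by omega)] at hi
      exact lt_irrefl _ hi
    have hk : k + 1 ≤ n := by
      by_contra! hlt
      rw [knot_eq_one hn (by omega), knot_eq_one hn (by omega)] at hi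
      exact lt_irrefl _ hi
    rw [add_assoc (p + 1), knot_add hn hk, knot_add hn (by omega)]
    push_cast
    ring
  simple i h0 h1 := by
    have hn' : (0 : ℝ) < n := by exact_mod_cast hn
    obtain ⟨k, rfl⟩ : ∃ k, i = p + 1 + k := by
      refine Nat.exists_eq_add_of_le ?_
      by_contra! hlt
      rw [knot_eq_zero (by omega)] at h0
      exact lt_irrefl _ h0
    have hk : k + 1 ≤ n := by
      by_contra! hlt
      rw [knot_eq_one hn (by omega)] at h1
      exact lt_irrefl _ h1
    rw [add_assoc (p + 1), knot_add hn hk, knot_add hn (by omega)]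
    gcongr
    simp
  pos := by positivity
  sine_pos _ := Family.sine_pos_of_admissible hn hF

/-! ### Uniform bounds on the local parameter -/

/-- Up to `π/2` the sine increases and the factor `1` suffices; beyond, it decreases, so `sin ν ≥
sin ν₀ > 0` while `sin y ≤ 1`. -/
theorem sin_le_max_mul_sin {ν ν₀ y : ℝ} (hν : ν ≤ ν₀) (hν₀ : ν₀ < Real.pi)
    (hy0 : 0 ≤ y) (hy : y ≤ ν) :
    Real.sin y ≤ max 1 (1 / Real.sin ν₀) * Real.sin ν := by
  have hs : 0 ≤ Real.sin ν := Real.sin_nonneg_of_nonneg_of_le_pi (by linarith) (by linarith)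
  rcases le_total ν (Real.pi / 2) with h | h
  · have h1 : Real.sin y ≤ Real.sin ν :=
      Real.sin_le_sin_of_le_of_le_pi_div_two (by linarith [Real.pi_pos]) h hy
    exact h1.trans (le_mul_of_one_le_left hs (le_max_left _ _))
  · have hs0 : 0 < Real.sin ν₀ :=
      Real.sin_pos_of_pos_of_lt_pi (by linarith [Real.pi_pos]) hν₀
    have h1 : Real.sin ν₀ ≤ Real.sin ν := by
      rw [← Real.sin_pi_sub ν₀, ← Real.sin_pi_sub ν]
      exact Real.sin_le_sin_of_le_of_le_pi_div_two (by linarith) (by linarith) (by linarith)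
    calc Real.sin y ≤ 1 := Real.sin_le_one y
      _ = 1 / Real.sin ν₀ * Real.sin ν₀ := by field_simp
      _ ≤ max 1 (1 / Real.sin ν₀) * Real.sin ν :=
        mul_le_mul (le_max_right _ _) h1 hs0.le (by positivity)

theorem Regime.param_div_le (R : Regime) {α : ℝ} (hα : 0 < α) {n : ℕ} (hn : 0 < n) :
    0 < R.param α n ∧ R.param α n * (1 / n) ≤ α := by
  have hn' : (0 : ℝ) < n := by exact_mod_cast hn
  cases R with
  | nonNested =>
    refine ⟨by unfold Regime.param; positivity, ?_⟩
    unfold Regime.param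
    field_simp
    exact le_rfl
  | nested =>
    refine ⟨hα, ?_⟩
    unfold Regime.param
    rw [mul_one_div]
    exact div_le_self hα.le (by exact_mod_cast hn)

/-- In the trigonometric case the local parameter `μ(n) / n` stays away from `π`. -/
theorem Regime.exists_param_bound (R : Regime) {α : ℝ} (hα : 0 < α) :
    ∃ ν₀ < Real.pi, ∀ n : ℕ, 0 < n → Family.trigonometric.Admissible (R.param α n) n →
      R.param α n * (1 / n) ≤ ν₀ := by
  cases R with
  | nonNested =>
    rcases lt_or_ge α Real.pi with h | h
    · exact ⟨α, h, fun n hn _ => (Regime.nonNested.param_div_le hα hn).2⟩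
    -- For `α ≥ π` no `n` is admissible and the bound is vacuous.
    · refine ⟨0, Real.pi_pos, fun n hn hadm => absurd hadm.2 (not_lt.2 ?_)⟩
      exact mul_le_mul_of_nonneg_left h n.cast_nonneg
  | nested =>
    -- The least admissible `n` is `⌊α/π⌋ + 1`, and `α / n` decreases in `n`.
    refine ⟨α / (⌊α / Real.pi⌋₊ + 1 : ℕ), ?_, fun n hn hadm => ?_⟩
    · rw [div_lt_iff₀ (by positivity), mul_comm, ← div_lt_iff₀ Real.pi_pos]
      push_cast
      exact Nat.lt_floor_add_one _
    · have h1 : ⌊α / Real.pi⌋₊ < n := by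
        rw [Nat.floor_lt (by positivity), div_lt_iff₀ Real.pi_pos]
        exact hadm.2
      unfold Regime.param
      rw [mul_one_div]
      gcongr
      exact h1

/-- Uniformity in `n` enters here: `M` bounds the splines of degree one, and `α ^ 2` is the
parameter `L` of the Markov inequality. -/
theorem exists_uniform_bound (F : Family) (R : Regime) {α : ℝ} (hα : 0 < α) :
    ∃ M, 1 ≤ M ∧ ∀ n : ℕ, 0 < n → F.Admissible (R.param α n) n →
      (∀ y : ℝ, 0 ≤ y → y ≤ 1 / n →
        F.sine (R.param α n * y) ≤ M * F.sine (R.param α n * (1 / n))) ∧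
      |F.sign * R.param α n ^ 2| * (1 / (n : ℝ)) ^ 2 ≤ α ^ 2 := by
  have hL : ∀ n : ℕ, 0 < n → |F.sign * R.param α n ^ 2| * (1 / (n : ℝ)) ^ 2 ≤ α ^ 2 := by
    intro n hn
    obtain ⟨h1, h2⟩ := R.param_div_le hα hn
    rw [abs_mul, F.abs_sign, one_mul, abs_of_nonneg (by positivity), ← mul_pow]
    gcongr
  cases F with
  | hyperbolic =>
    refine ⟨1, le_rfl, fun n hn _ => ⟨fun y _ hy => ?_, hL n hn⟩⟩
    rw [one_mul]
    refine Real.sinh_le_sinh.2 ?_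
    gcongr
    exact (R.param_div_le hα hn).1.le
  | trigonometric =>
    obtain ⟨ν₀, hν₀, hb⟩ := R.exists_param_bound hα
    refine ⟨max 1 (1 / Real.sin ν₀), le_max_left _ _, fun n hn hadm => ⟨fun y hy0 hy => ?_, hL n hn⟩⟩
    have hμ := (R.param_div_le hα hn).1.le
    exact sin_le_max_mul_sin (hb n hn hadm) hν₀ (by positivity) (by gcongr)

/-! ### Stability in `L²` -/

theorem stabConst_pos {M L : ℝ} (hM : 0 ≤ M) (hL : 0 ≤ L) : ∀ q, 0 < stabConst M L q
  | 0 => zero_lt_one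
  | q + 1 => by
    have h1 := stabConst_pos hM hL q
    have h2 := markovConst_pos hL (q + 1)
    rw [stabConst]
    positivity

/-- On an interval of length `h`, the maximum norm of a section is controlled by its `L²` norm. -/
theorem IsSection.exists_bound {κ L h : ℝ} (hh : 0 < h) (hL : |κ| * h ^ 2 ≤ L) {q : ℕ}
    {f : ℝ → ℝ} (hf : IsSection κ q f) (a : ℝ) :
    ∃ A, (∀ x ∈ Set.Icc a (a + h), |f x| ≤ A) ∧
      A ^ 2 * h ≤ markovConst L (q + 1) * ∫ x in a..(a + h), f x ^ 2 := by
  have hL0 : 0 ≤ L := le_trans (by positivity) hL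
  obtain ⟨x₀, hx₀, hmax⟩ := (isCompact_Icc (a := a) (b := a + h)).exists_isMaxOn
    ⟨a, by simp [hh.le]⟩ (hf.continuous.abs.continuousOn)
  have hA : ∀ y ∈ Set.Icc a (a + h), |f y| ≤ |f x₀| := fun y hy => hmax hy
  refine ⟨|f x₀|, hA, ?_⟩
  obtain ⟨g, hg⟩ : ∃ g : ℝ → ℝ, ∀ x, HasDerivAt f (g x) x := by
    cases q with
    | zero => obtain ⟨g, hg, -⟩ := hf; exact ⟨g, hg⟩
    | succ q => obtain ⟨g, -, hg⟩ := hf; exact ⟨g, hg⟩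
  have hgb := hf.abs_deriv_le hh hL hg hA
  set A := |f x₀| with hAdef
  have hA0 : 0 ≤ A := abs_nonneg _
  set B := markovConst L q with hB
  have hB0 : 0 < B := markovConst_pos hL0 q
  rw [markovConst, ← hB]
  set m := max 1 (2 * B) with hm
  have hm1 : 1 ≤ m := le_max_left _ _
  have hm2 : 2 * B ≤ m := le_max_right _ _
  have hm0 : 0 < m := by linarith
  have hle : h / m ≤ h := div_le_self hh.le hm1
  -- On a subinterval of length `h / m` containing the maximum point `x₀`, the derivative bound
  -- keeps `|f| ≥ A / 2`, so `f²` has integral at least `(h / m) A² / 4`.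
  have hη : 0 < h / m := by positivity
  obtain ⟨u, hu1, hu2, hu3, hu4⟩ := exists_subinterval hη (by linarith) hx₀
  have hlow : ∀ x ∈ Set.Icc u (u + h / m), A ^ 2 / 4 ≤ f x ^ 2 := by
    intro x hx
    have h2 : ‖f x - f x₀‖ ≤ B / h * A * ‖x - x₀‖ :=
      (convex_Icc a (a + h)).norm_image_sub_le_of_norm_hasDerivWithin_le
        (fun y _ => (hg y).hasDerivWithinAt) (fun y hy => hgb y hy) hx₀
        ⟨by linarith [hx.1], by linarith [hx.2]⟩
    have h3 : |x - x₀| ≤ h / m := by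
      rw [abs_le]; constructor <;> linarith [hx.1, hx.2]
    rw [Real.norm_eq_abs, Real.norm_eq_abs] at h2
    have h4 : B / h * A * |x - x₀| ≤ B / h * A * (h / m) := by gcongr
    have e1 : B / h * A * (h / m) = B / m * A := by field_simp
    have e2 : B / m ≤ 1 / 2 := by rw [div_le_iff₀ hm0]; linarith
    have e3 : B / m * A ≤ 1 / 2 * A := by gcongr
    have h5 := abs_sub_abs_le_abs_sub (f x₀) (f x)
    rw [abs_sub_comm] at h5
    have h6 : A / 2 ≤ |f x| := by linarith
    rw [← sq_abs (f x)]
    calc A ^ 2 / 4 = (A / 2) ^ 2 := by ring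
      _ ≤ |f x| ^ 2 := by gcongr
  have hcont : Continuous fun x => f x ^ 2 := hf.continuous.pow 2
  have h1 : ∫ _ in u..(u + h / m), A ^ 2 / 4 ≤ ∫ x in u..(u + h / m), f x ^ 2 :=
    intervalIntegral.integral_mono_on (by linarith) (by simp) (hcont.intervalIntegrable _ _) hlow
  have h2 : ∫ x in u..(u + h / m), f x ^ 2 ≤ ∫ x in a..(a + h), f x ^ 2 :=
    intervalIntegral.integral_mono_interval hu1 (by linarith) hu2
      (Filter.Eventually.of_forall fun x => sq_nonneg _) (hcont.intervalIntegrable _ _)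
  rw [intervalIntegral.integral_const, add_sub_cancel_left, smul_eq_mul] at h1
  calc A ^ 2 * h = 4 * m * (h / m * (A ^ 2 / 4)) := by field_simp
    _ ≤ 4 * m * ∫ x in a..(a + h), f x ^ 2 := by
      have := h1.trans h2
      gcongr

section Stability

variable {F : Family} {μ : ℝ} {t : ℕ → ℝ} {p : ℕ} {h M L : ℝ} {q : ℕ}

theorem SplineFacts.continuous_splineSum (H : SplineFacts F μ t M L q) (c : ℕ → ℝ) (b : ℕ) :
    Continuous (splineSum F μ t q c b) :=
  continuous_finsetSum _ fun j _ => continuous_const.mul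
    ((H.continuous_primitive j).sub (H.continuous_primitive (j + 1)))

theorem SplineFacts.sq_coeff_le (H : SplineFacts F μ t M L q)
    (H' : SplineFacts F μ t M L (q + 1)) (G : IsGrid F μ t p h)
    (hL : |F.sign * μ ^ 2| * h ^ 2 ≤ L) (c : ℕ → ℝ) {m K : ℕ} (hm : t m < t (m + 1))
    (hmK : m < K) {i : ℕ} (hi : i ≤ m) (him : m ≤ i + q + 2) :
    c i ^ 2 * h ≤ stabConst M L (q + 1) ^ 2 * markovConst L (q + 2)
      * ∫ x in t m..t (m + 1), splineSum F μ t q c K x ^ 2 := by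
  have hsub : Set.Ioo (t m) (t (m + 1)) ⊆ Set.Ioo 0 1 :=
    Set.Ioo_subset_Ioo (G.nonneg m) (G.le_one _)
  have hb : t (m + 1) = t m + h := by linarith [G.step m hm]
  choose f hf hfe using fun i => H'.piece i m hm
  have hsec := IsSection.sum (Finset.range K) c fun j _ => hf j
  set f' : ℝ → ℝ := fun x => ∑ j ∈ Finset.range K, c j * f j x with hf'
  have hse : ∀ x ∈ Set.Ioo (t m) (t (m + 1)),
      ∑ j ∈ Finset.range K, c j * basisFun F μ t (q + 2) j x = f' x :=
    fun x hx => Finset.sum_congr rfl fun j _ => by rw [hfe j hx]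
  obtain ⟨A, hA, hAint⟩ := hsec.exists_bound G.pos hL (t m)
  have hc := H'.stable m K hm hmK c A (fun x hx => by
    rw [hse x hx]
    exact hA x ⟨hx.1.le, by rw [← hb]; exact hx.2.le⟩) i hi (by omega)
  have hint : ∫ x in t m..t (m + 1), splineSum F μ t q c K x ^ 2
      = ∫ x in t m..(t m + h), f' x ^ 2 := by
    rw [← hb, intervalIntegral.integral_of_le hm.le, intervalIntegral.integral_of_le hm.le,
      MeasureTheory.integral_Ioc_eq_integral_Ioo, MeasureTheory.integral_Ioc_eq_integral_Ioo]
    refine MeasureTheory.setIntegral_congr_fun measurableSet_Ioo fun x hx => ?_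
    rw [← hse x hx, ← H.eqOn_splineSum G c K (hsub hx)]
  rw [hint]
  have h1 : c i ^ 2 ≤ (stabConst M L (q + 1) * A) ^ 2 := by
    rw [← sq_abs (c i)]
    exact pow_le_pow_left₀ (abs_nonneg _) hc 2
  have hh := G.pos
  calc c i ^ 2 * h ≤ (stabConst M L (q + 1) * A) ^ 2 * h := by gcongr
    _ = stabConst M L (q + 1) ^ 2 * (A ^ 2 * h) := by ring
    _ ≤ stabConst M L (q + 1) ^ 2
        * (markovConst L (q + 1 + 1) * ∫ x in t m..(t m + h), f' x ^ 2) := by gcongr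
    _ = _ := by ring

/-- Stability in `L²([0,1])` of the splines of degree `q + 2`. -/
theorem SplineFacts.sum_sq_le (H : SplineFacts F μ t M L q)
    (H' : SplineFacts F μ t M L (q + 1)) (G : IsGrid F μ t (q + 2) h)
    (hL : |F.sign * μ ^ 2| * h ^ 2 ≤ L) {c : ℕ → ℝ} {K : ℕ} (hK : t K = 1)
    (hsupp : ∀ m, q + 3 ≤ m → m < K → t m < t (m + 1)) (hc0 : c 0 = 0) :
    (∑ i ∈ Finset.range K, c i ^ 2) * h ≤
      (q + 4) * (stabConst M L (q + 1) ^ 2 * markovConst L (q + 2))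
        * ∫ x in (0 : ℝ)..1, splineSum F μ t q c K x ^ 2 := by
  have hL0 : 0 ≤ L := le_trans (mul_nonneg (abs_nonneg _) (sq_nonneg _)) hL
  set D := stabConst M L (q + 1) ^ 2 * markovConst L (q + 2) with hD
  have hD0 : 0 ≤ D := mul_nonneg (sq_nonneg _) (markovConst_pos hL0 _).le
  set J : ℕ → ℝ := fun m => ∫ x in t m..t (m + 1), splineSum F μ t q c K x ^ 2 with hJ
  have hcont : Continuous fun x => splineSum F μ t q c K x ^ 2 :=
    (H.continuous_splineSum c K).pow 2
  have hJ0 : ∀ m, 0 ≤ J m := fun m =>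
    intervalIntegral.integral_nonneg (G.monotone (Nat.le_succ m)) fun _ _ => sq_nonneg _
  set I := ∫ x in (0 : ℝ)..1, splineSum F μ t q c K x ^ 2 with hI
  have hsum : ∑ m ∈ Finset.range K, J m = I := by
    rw [hJ, intervalIntegral.sum_integral_adjacent_intervals
      fun k _ => hcont.intervalIntegrable _ _, hK, G.eq_zero 0 (by omega)]
  have hq : q + 3 < K := by
    by_contra! hcon
    have := G.eq_zero K (by omega)
    linarith
  have hI0 : 0 ≤ I := by rw [← hsum]; exact Finset.sum_nonneg fun m _ => hJ0 m
  have hJq : J (q + 3) ≤ I := by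
    rw [← hsum]
    exact Finset.single_le_sum (fun m _ => hJ0 m) (Finset.mem_range.2 hq)
  -- Each coefficient with `i ≥ q + 3` is charged to its own interval `[t i, t (i + 1)]`. Those with
  -- `1 ≤ i < q + 3`, whose intervals are degenerate, are charged to the first nondegenerate one, `m
  -- = q + 3`. The spline of index `0` vanishes on `(0,1)`, so its coefficient has to be zero by
  -- assumption. In total this costs `q + 4` times the full integral.
  have hterm : ∀ i ∈ Finset.range K,
      c i ^ 2 * h ≤ D * (J i + if i < q + 3 then I else 0) := by
    intro i hi
    have hi := Finset.mem_range.1 hi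
    rcases Nat.eq_zero_or_pos i with rfl | hi0
    · rw [hc0, if_pos (by omega)]
      have := hJ0 0
      rw [zero_pow two_ne_zero, zero_mul]
      positivity
    · rcases Nat.lt_or_ge i (q + 3) with hiq | hiq
      · have := H.sq_coeff_le H' G hL c (hsupp (q + 3) le_rfl hq) hq hiq.le
          (show q + 3 ≤ i + q + 2 by omega)
        refine this.trans ?_
        rw [if_pos hiq]
        have := hJ0 i
        gcongr
        linarith
      · have := H.sq_coeff_le H' G hL c (hsupp i hiq hi) hi le_rfl
          (show i ≤ i + q + 2 by omega)
        rw [if_neg (by omega), add_zero]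
        exact this
  rw [Finset.sum_mul]
  refine (Finset.sum_le_sum hterm).trans ?_
  rw [← Finset.mul_sum, Finset.sum_add_distrib, hsum]
  have hcount : ∑ i ∈ Finset.range K, (if i < q + 3 then I else 0) = (q + 3) * I := by
    rw [← Finset.sum_filter, Finset.sum_const, nsmul_eq_mul]
    have : (Finset.range K).filter (fun i => i < q + 3) = Finset.range (q + 3) := by
      ext i
      simp only [Finset.mem_filter, Finset.mem_range]
      omega
    rw [this, Finset.card_range]
    push_cast
    ring
  rw [hcount]
  refine le_of_eq ?_
  ring

end Stability

/-! ### Interior splines -/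

/-- The coefficients of a combination of interior splines with respect to all splines. -/
def extendCoeff (n p : ℕ) (x : Fin (n + p - 2) → ℝ) (j : ℕ) : ℝ :=
  if hj : 2 ≤ j ∧ j - 2 < n + p - 2 then x ⟨j - 2, hj.2⟩ else 0

/-- The indices `0`, `1` and `n + p` carry the coefficient `0`. A general `φ` covers both the spline
sum and the sum of squares. -/
theorem sum_extendCoeff {n p : ℕ} (hp : 2 ≤ n + p) (x : Fin (n + p - 2) → ℝ) (φ : ℝ → ℕ → ℝ)
    (hφ : ∀ j, φ 0 j = 0) :
    ∑ j ∈ Finset.range (n + p + 1), φ (extendCoeff n p x j) j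
      = ∑ i, φ (x i) (i + 2) := by
  rw [show n + p + 1 = (n + p - 2) + 1 + 2 by omega, Finset.sum_range_succ', Finset.sum_range_succ',
    Finset.sum_range_succ, ← Fin.sum_univ_eq_sum_range
      (fun j => φ (extendCoeff n p x (j + 1 + 1)) (j + 1 + 1))]
  have e1 : extendCoeff n p x (n + p - 2 + 1 + 1) = 0 := dif_neg (by omega)
  have e2 : extendCoeff n p x (0 + 1) = 0 := dif_neg (by omega)
  have e3 : extendCoeff n p x 0 = 0 := dif_neg (by omega)
  rw [e1, e2, e3, hφ, hφ, hφ, add_zero, add_zero, add_zero]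
  refine Finset.sum_congr rfl fun i _ => ?_
  have e4 : extendCoeff n p x (i + 1 + 1) = x i := by
    rw [extendCoeff, dif_pos ⟨by omega, by have := i.2; omega⟩]
    exact congrArg x (Fin.ext (by simp))
  rw [e4]

/-! ### The Wirtinger inequality -/

theorem intervalIntegrable_of_bounded {f : ℝ → ℝ} {B : ℝ} (hf : ContinuousOn f (Set.Ioo 0 1))
    (hB : ∀ x ∈ Set.Ioo (0 : ℝ) 1, |f x| ≤ B) :
    IntervalIntegrable f MeasureTheory.volume 0 1 :=
  (intervalIntegrable_iff_integrableOn_Ioo_of_le zero_le_one).2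
    (MeasureTheory.IntegrableOn.of_bound (by simp) (hf.aestronglyMeasurable measurableSet_Ioo) B
      ((MeasureTheory.ae_restrict_iff' measurableSet_Ioo).2
        (Filter.Eventually.of_forall fun x hx => hB x hx)))

/-- Completing the square with `π cot (π x)`, the logarithmic derivative of the extremal function
`sin (π x)`: the Wirtinger integrand is an exact derivative plus a square. -/
theorem hasDerivAt_cot_mul_sq {u v : ℝ → ℝ} {x : ℝ} (hx : x ∈ Set.Ioo (0 : ℝ) 1)
    (hu : HasDerivAt u (v x) x) :
    HasDerivAt (fun y => Real.pi * Real.cos (Real.pi * y) / Real.sin (Real.pi * y) * u y ^ 2)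
      (v x ^ 2 - Real.pi ^ 2 * u x ^ 2
        - (v x - Real.pi * Real.cos (Real.pi * x) / Real.sin (Real.pi * x) * u x) ^ 2) x := by
  have hs : 0 < Real.sin (Real.pi * x) :=
    Real.sin_pos_of_pos_of_lt_pi (mul_pos Real.pi_pos hx.1)
      (by nlinarith [Real.pi_pos, hx.2])
  have hl : HasDerivAt (fun y : ℝ => Real.pi * y) Real.pi x := by
    simpa using (hasDerivAt_id x).const_mul Real.pi
  have hcos := hl.cos.const_mul Real.pi
  have hsin := hl.sin
  refine ((hcos.div hsin hs.ne').mul (hu.pow 2)).congr_deriv ?_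
  simp only [Pi.pow_apply, Pi.div_apply]
  field_simp
  ring

/-- Jordan's inequality gives `sin (π ε) ≥ 2 ε`, so the simple pole of the cotangent is outweighed
by the square of a function of size `O(ε)`. -/
theorem abs_cot_mul_sq_le {ε w B : ℝ} (hε : 0 < ε) (hε' : ε ≤ 1 / 2) (hw : |w| ≤ B * ε)
    (c : ℝ) (hc : |c| ≤ 1) :
    |Real.pi * c / Real.sin (Real.pi * ε) * w ^ 2| ≤ Real.pi * B ^ 2 / 2 * ε := by
  have hπ := Real.pi_pos
  have hs : 2 * ε ≤ Real.sin (Real.pi * ε) := by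
    have := Real.mul_le_sin (x := Real.pi * ε) (by positivity) (by nlinarith)
    calc 2 * ε = 2 / Real.pi * (Real.pi * ε) := by field_simp
      _ ≤ _ := this
  have hs0 : 0 < Real.sin (Real.pi * ε) := by linarith
  rw [abs_mul, abs_div, abs_mul, abs_of_pos hπ, abs_of_pos hs0, abs_of_nonneg (sq_nonneg w),
    ← sq_abs w]
  calc Real.pi * |c| / Real.sin (Real.pi * ε) * |w| ^ 2
      ≤ Real.pi * 1 / (2 * ε) * (B * ε) ^ 2 := by gcongr
    _ = Real.pi * B ^ 2 / 2 * ε := by field_simp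

/-- The Wirtinger inequality `π² ∫ u² ≤ ∫ u'²` on `[0,1]` with zero boundary values. -/
theorem wirtinger {u v : ℝ → ℝ} {B : ℝ} (hu : Continuous u) (h0 : u 0 = 0) (h1 : u 1 = 0)
    (hv : ContinuousOn v (Set.Ioo 0 1)) (hB : ∀ x ∈ Set.Ioo (0 : ℝ) 1, |v x| ≤ B)
    (huv : ∀ x ∈ Set.Ioo (0 : ℝ) 1, HasDerivAt u (v x) x) :
    Real.pi ^ 2 * ∫ x in (0 : ℝ)..1, u x ^ 2 ≤ ∫ x in (0 : ℝ)..1, v x ^ 2 := by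
  have hB0 : 0 ≤ B := (abs_nonneg _).trans (hB (1 / 2) (by norm_num))
  have hleft : ∀ x ∈ Set.Ioo (0 : ℝ) 1, |u x| ≤ B * x := by
    intro x hx
    obtain ⟨ξ, hξ, hξ'⟩ := exists_hasDerivAt_eq_slope u v hx.1 hu.continuousOn
      fun y hy => huv y ⟨hy.1, hy.2.trans hx.2⟩
    have := hB ξ ⟨hξ.1, hξ.2.trans hx.2⟩
    rwa [hξ', h0, sub_zero, sub_zero, abs_div, abs_of_pos hx.1, div_le_iff₀ hx.1] at this
  have hright : ∀ x ∈ Set.Ioo (0 : ℝ) 1, |u x| ≤ B * (1 - x) := by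
    intro x hx
    have hx' : 0 < 1 - x := by linarith [hx.2]
    obtain ⟨ξ, hξ, hξ'⟩ := exists_hasDerivAt_eq_slope u v hx.2 hu.continuousOn
      fun y hy => huv y ⟨hx.1.trans hy.1, hy.2⟩
    have := hB ξ ⟨hx.1.trans hξ.1, hξ.2⟩
    rwa [hξ', h1, zero_sub, abs_div, abs_neg, abs_of_pos hx', div_le_iff₀ hx'] at this
  have hv2 : IntervalIntegrable (fun x => v x ^ 2) MeasureTheory.volume 0 1 :=
    intervalIntegrable_of_bounded (hv.pow 2) (B := B ^ 2) fun x hx => by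
      rw [abs_pow]; exact pow_le_pow_left₀ (abs_nonneg _) (hB x hx) 2
  have hu2 : Continuous fun x => u x ^ 2 := hu.pow 2
  set Iv := ∫ x in (0 : ℝ)..1, v x ^ 2
  set Iu := ∫ x in (0 : ℝ)..1, u x ^ 2 with hIu
  -- The cotangent is singular at both ends, so integration runs over `[ε, 1 - ε]`. The error
  -- consists of two boundary terms, `π B² / 2 * ε` each, and of `π²` times the integrals of `u²`
  -- over the two omitted ends, at most `B² ε` each.
  have main : ∀ ε : ℝ, 0 < ε → ε < 1 / 2 →
      Real.pi ^ 2 * Iu ≤ Iv + (2 * Real.pi ^ 2 * B ^ 2 + Real.pi * B ^ 2) * ε := by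
    intro ε hε hε'
    have hsub : Set.Icc ε (1 - ε) ⊆ Set.Ioo 0 1 := fun x hx =>
      ⟨by linarith [hx.1], by linarith [hx.2]⟩
    have hle : ε ≤ 1 - ε := by linarith
    have hsin : ∀ x ∈ Set.Icc ε (1 - ε), Real.sin (Real.pi * x) ≠ 0 := fun x hx =>
      (Real.sin_pos_of_pos_of_lt_pi (mul_pos Real.pi_pos (hsub hx).1)
        (by nlinarith [Real.pi_pos, (hsub hx).2])).ne'
    have hvc : ContinuousOn v (Set.Icc ε (1 - ε)) := hv.mono hsub
    have huc : ContinuousOn u (Set.Icc ε (1 - ε)) := hu.continuousOn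
    have hcot : ContinuousOn (fun x => Real.pi * Real.cos (Real.pi * x) / Real.sin (Real.pi * x))
        (Set.Icc ε (1 - ε)) :=
      ContinuousOn.div (by fun_prop) (by fun_prop) hsin
    have hftc := intervalIntegral.integral_eq_sub_of_hasDerivAt
      (a := ε) (b := 1 - ε)
      (fun x hx => hasDerivAt_cot_mul_sq (hsub (by rwa [Set.uIcc_of_le hle] at hx))
        (huv x (hsub (by rwa [Set.uIcc_of_le hle] at hx))))
      (ContinuousOn.intervalIntegrable_of_Icc hle
        (((hvc.pow 2).sub ((huc.pow 2).const_mul _)).sub ((hvc.sub (hcot.mul huc)).pow 2)))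
    have hi1 : IntervalIntegrable (fun x => v x ^ 2 - Real.pi ^ 2 * u x ^ 2)
        MeasureTheory.volume ε (1 - ε) :=
      ContinuousOn.intervalIntegrable_of_Icc hle ((hvc.pow 2).sub ((huc.pow 2).const_mul _))
    have hi2 : IntervalIntegrable (fun x =>
        (v x - Real.pi * Real.cos (Real.pi * x) / Real.sin (Real.pi * x) * u x) ^ 2)
        MeasureTheory.volume ε (1 - ε) :=
      ContinuousOn.intervalIntegrable_of_Icc hle ((hvc.sub (hcot.mul huc)).pow 2)
    have hi3 : IntervalIntegrable (fun x => v x ^ 2) MeasureTheory.volume ε (1 - ε) :=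
      ContinuousOn.intervalIntegrable_of_Icc hle (hvc.pow 2)
    have hi4 : IntervalIntegrable (fun x => Real.pi ^ 2 * u x ^ 2)
        MeasureTheory.volume ε (1 - ε) :=
      ContinuousOn.intervalIntegrable_of_Icc hle ((huc.pow 2).const_mul _)
    rw [intervalIntegral.integral_sub hi1 hi2, intervalIntegral.integral_sub hi3 hi4,
      intervalIntegral.integral_const_mul] at hftc
    have hnn : 0 ≤ ∫ x in ε..(1 - ε),
        (v x - Real.pi * Real.cos (Real.pi * x) / Real.sin (Real.pi * x) * u x) ^ 2 :=
      intervalIntegral.integral_nonneg hle fun _ _ => sq_nonneg _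
    have hb1 := abs_cot_mul_sq_le hε hε'.le (hleft ε (hsub (Set.left_mem_Icc.2 hle)))
      (Real.cos (Real.pi * ε)) (Real.abs_cos_le_one _)
    have hb2 := abs_cot_mul_sq_le hε hε'.le
      (show |u (1 - ε)| ≤ B * ε by
        have := hright (1 - ε) (hsub (Set.right_mem_Icc.2 hle))
        rwa [sub_sub_cancel] at this)
      (Real.cos (Real.pi * (1 - ε))) (Real.abs_cos_le_one _)
    have hse : Real.sin (Real.pi * (1 - ε)) = Real.sin (Real.pi * ε) := by
      rw [mul_sub, mul_one, Real.sin_pi_sub]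
    rw [← hse] at hb2
    have hvle : ∫ x in ε..(1 - ε), v x ^ 2 ≤ Iv :=
      intervalIntegral.integral_mono_interval hε.le hle (by linarith)
        (Filter.Eventually.of_forall fun x => sq_nonneg _) hv2
    have hsq : ∀ x ∈ Set.Ioo (0 : ℝ) 1, u x ^ 2 ≤ B ^ 2 := fun x hx => by
      rw [← sq_abs]
      refine pow_le_pow_left₀ (abs_nonneg _) ((hleft x hx).trans ?_) 2
      exact mul_le_of_le_one_right hB0 hx.2.le
    have hsplit : Iu = (∫ x in (0 : ℝ)..ε, u x ^ 2) + (∫ x in ε..(1 - ε), u x ^ 2)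
        + ∫ x in (1 - ε)..1, u x ^ 2 := by
      rw [intervalIntegral.integral_add_adjacent_intervals (hu2.intervalIntegrable _ _)
        (hu2.intervalIntegrable _ _), intervalIntegral.integral_add_adjacent_intervals
        (hu2.intervalIntegrable _ _) (hu2.intervalIntegrable _ _)]
    have hs1 : ∫ x in (0 : ℝ)..ε, u x ^ 2 ≤ B ^ 2 * ε := by
      have := intervalIntegral.integral_mono_on_of_le_Ioo
        (μ := MeasureTheory.volume) hε.le (hu2.intervalIntegrable 0 ε)
        (continuous_const.intervalIntegrable _ _)
        fun x hx => hsq x ⟨hx.1, by linarith [hx.2]⟩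
      simpa [mul_comm] using this
    have hs2 : ∫ x in (1 - ε)..1, u x ^ 2 ≤ B ^ 2 * ε := by
      have := intervalIntegral.integral_mono_on_of_le_Ioo
        (μ := MeasureTheory.volume) (show 1 - ε ≤ 1 by linarith)
        (hu2.intervalIntegrable (1 - ε) 1) (continuous_const.intervalIntegrable _ _)
        fun x hx => hsq x ⟨by linarith [hx.1], hx.2⟩
      simpa [mul_comm] using this
    have hb1' := neg_le_of_abs_le hb1
    have hb2' := neg_le_of_abs_le hb2
    have hb1'' := le_of_abs_le hb1
    have hπ2 : 0 ≤ Real.pi ^ 2 := sq_nonneg _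
    have hm := mul_le_mul_of_nonneg_left (add_le_add hs1 hs2) hπ2
    rw [hsplit]
    nlinarith
  refine le_of_forall_pos_le_add fun δ hδ => ?_
  set k := 2 * Real.pi ^ 2 * B ^ 2 + Real.pi * B ^ 2 with hk
  have hk0 : 0 ≤ k := by have := Real.pi_pos; positivity
  have h2 := main (min (1 / 4) (δ / (k + 1))) (by positivity)
    ((min_le_left _ _).trans_lt (by norm_num))
  have h3 : k * min (1 / 4) (δ / (k + 1)) ≤ δ := by
    calc k * min (1 / 4) (δ / (k + 1)) ≤ k * (δ / (k + 1)) := by gcongr; exact min_le_right _ _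
      _ = k / (k + 1) * δ := by ring
      _ ≤ 1 * δ := by gcongr; rw [div_le_one (by positivity)]; linarith
      _ = δ := one_mul δ
  linarith

/-! ### Quadratic forms and eigenvalues -/

theorem dotProduct_gram_mulVec {m : ℕ} {u : Fin m → ℝ → ℝ} {B : Fin m → ℝ}
    (hu : ∀ i, ContinuousOn (u i) (Set.Ioo 0 1))
    (hB : ∀ i, ∀ x ∈ Set.Ioo (0 : ℝ) 1, |u i x| ≤ B i) (a : ℝ) (x : Fin m → ℝ) :
    dotProduct x ((Matrix.of fun i j => a * ∫ s in (0 : ℝ)..1, u j s * u i s).mulVec x)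
      = a * ∫ s in (0 : ℝ)..1, (∑ i, x i * u i s) ^ 2 := by
  have hint : ∀ i j, IntervalIntegrable (fun s => x i * x j * (u j s * u i s))
      MeasureTheory.volume 0 1 := fun i j =>
    (intervalIntegrable_of_bounded ((hu j).mul (hu i)) (B := B j * B i) fun s hs => by
      rw [Pi.mul_apply, abs_mul]
      exact mul_le_mul (hB j s hs) (hB i s hs) (abs_nonneg _)
        ((abs_nonneg _).trans (hB j s hs))).const_mul _
  have e : ∀ s, (∑ i, x i * u i s) ^ 2 = ∑ i, ∑ j, x i * x j * (u j s * u i s) := by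
    intro s
    rw [sq, Finset.sum_mul_sum]
    exact Finset.sum_congr rfl fun i _ => Finset.sum_congr rfl fun j _ => by ring
  simp_rw [e]
  have hint' : ∀ i, IntervalIntegrable (fun s => ∑ j, x i * x j * (u j s * u i s))
      MeasureTheory.volume 0 1 := fun i => by
    simpa only [Finset.sum_fn] using
      IntervalIntegrable.sum Finset.univ (f := fun j s => x i * x j * (u j s * u i s))
        fun j _ => hint i j
  rw [intervalIntegral.integral_finsetSum fun i _ => hint' i]
  simp_rw [intervalIntegral.integral_finsetSum fun j _ => hint _ j,
    intervalIntegral.integral_const_mul, dotProduct, Matrix.mulVec, dotProduct, Matrix.of_apply,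
    Finset.mul_sum]
  exact Finset.sum_congr rfl fun i _ => Finset.sum_congr rfl fun j _ => by ring

/-- An eigenvalue is the value of the form at a unit eigenvector. Positivity of `m` matters, since
an infimum over the empty family is `0`. -/
theorem le_lambdaMin {m : ℕ} (hm : 0 < m) {A : Matrix (Fin m) (Fin m) ℝ} (hA : A.IsHermitian)
    {C : ℝ} (h : ∀ x : Fin m → ℝ, C * ∑ i, x i ^ 2 ≤ dotProduct x (A.mulVec x)) :
    C ≤ lambdaMin hA := by
  have : Nonempty (Fin m) := ⟨⟨0, hm⟩⟩
  refine le_ciInf fun i => ?_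
  rw [hA.eigenvalues_eq]
  have h1 := h (hA.eigenvectorBasis i)
  have h2 : ∑ j, hA.eigenvectorBasis i j ^ 2 = 1 := by
    have := EuclideanSpace.norm_sq_eq (hA.eigenvectorBasis i)
    rw [hA.eigenvectorBasis.orthonormal.1 i] at this
    simpa using this.symm
  rw [h2, mul_one] at h1
  simpa using h1

/-! ### Derivatives of the splines inside `(0,1)`. -/

section Degree

variable {F : Family} {μ : ℝ} {t : ℕ → ℝ} {p : ℕ} {h M L : ℝ} {q : ℕ}

/-- The derivative of the `i`-th spline of degree `q + 2`. -/
def basisDeriv (F : Family) (μ : ℝ) (t : ℕ → ℝ) (q i : ℕ) (x : ℝ) : ℝ :=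
  basisFun F μ t (q + 1) i x / mass F μ t q i
    - basisFun F μ t (q + 1) (i + 1) x / mass F μ t q (i + 1)

theorem SplineFacts.hasDerivAt_succ (H : SplineFacts F μ t M L q) (G : IsGrid F μ t p h) (i : ℕ)
    {x : ℝ} (hx : x ∈ Set.Ioo (0 : ℝ) 1) :
    HasDerivAt (basisFun F μ t (q + 2) i) (basisDeriv F μ t q i x) x :=
  ((H.hasDerivAt_primitive i hx).sub (H.hasDerivAt_primitive (i + 1) hx)).congr_of_eventuallyEq
    (Filter.eventuallyEq_of_mem (isOpen_Ioo.mem_nhds hx) fun _ hy => H.basisFun_succ G i hy)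

theorem SplineFacts.continuousOn_basisDeriv (H : SplineFacts F μ t M L q) (i : ℕ) :
    ContinuousOn (basisDeriv F μ t q i) (Set.Ioo 0 1) :=
  ((H.continuousOn i).div_const _).sub ((H.continuousOn (i + 1)).div_const _)

theorem SplineFacts.abs_basisDeriv_le (H : SplineFacts F μ t M L q) (i : ℕ)
    {x : ℝ} (hx : x ∈ Set.Ioo (0 : ℝ) 1) :
    |basisDeriv F μ t q i x| ≤ M / mass F μ t q i + M / mass F μ t q (i + 1) := by
  have key : ∀ j, |basisFun F μ t (q + 1) j x / mass F μ t q j| ≤ M / mass F μ t q j := by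
    intro j
    rw [abs_div, abs_of_nonneg (H.nonneg j x hx), abs_of_nonneg (H.mass_nonneg j)]
    exact div_le_div_of_nonneg_right (H.le j x hx) (H.mass_nonneg j)
  exact (abs_sub _ _).trans (add_le_add (key i) (key (i + 1)))

end Degree

/-! ### The quadratic forms of the interior splines. -/

section Main

variable {F : Family} {μ : ℝ} {n q : ℕ} {M L : ℝ}

theorem splineSum_extendCoeff_eq (H : SplineFacts F μ (knot n (q + 2)) M L q)
    (G : IsGrid F μ (knot n (q + 2)) (q + 2) (1 / n)) (x : Fin (n + (q + 2) - 2) → ℝ) {s : ℝ}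
    (hs : s ∈ Set.Ioo (0 : ℝ) 1) :
    splineSum F μ (knot n (q + 2)) q (extendCoeff n (q + 2) x) (n + (q + 2) + 1) s
      = ∑ i, x i * interiorSpline F μ n (q + 2) i s := by
  rw [← H.eqOn_splineSum G _ _ hs]
  exact sum_extendCoeff (by omega) x
    (fun r j => r * basisFun F μ (knot n (q + 2)) (q + 2) j s) fun j => zero_mul _

theorem integral_sq_splineSum_eq (H : SplineFacts F μ (knot n (q + 2)) M L q)
    (G : IsGrid F μ (knot n (q + 2)) (q + 2) (1 / n)) (x : Fin (n + (q + 2) - 2) → ℝ) :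
    ∫ s in (0 : ℝ)..1,
        splineSum F μ (knot n (q + 2)) q (extendCoeff n (q + 2) x) (n + (q + 2) + 1) s ^ 2
      = ∫ s in (0 : ℝ)..1, (∑ i, x i * interiorSpline F μ n (q + 2) i s) ^ 2 := by
  rw [intervalIntegral.integral_of_le zero_le_one, intervalIntegral.integral_of_le zero_le_one,
    MeasureTheory.integral_Ioc_eq_integral_Ioo, MeasureTheory.integral_Ioc_eq_integral_Ioo]
  exact MeasureTheory.setIntegral_congr_fun measurableSet_Ioo fun s hs => by
    simp only [splineSum_extendCoeff_eq H G x hs]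

theorem sum_sq_le_integral (H : SplineFacts F μ (knot n (q + 2)) M L q)
    (H' : SplineFacts F μ (knot n (q + 2)) M L (q + 1))
    (G : IsGrid F μ (knot n (q + 2)) (q + 2) (1 / n))
    (hL : |F.sign * μ ^ 2| * (1 / (n : ℝ)) ^ 2 ≤ L) (hn : 0 < n)
    (x : Fin (n + (q + 2) - 2) → ℝ) :
    (∑ i, x i ^ 2) * (1 / n) ≤
      (q + 4) * (stabConst M L (q + 1) ^ 2 * markovConst L (q + 2))
        * ∫ s in (0 : ℝ)..1, (∑ i, x i * interiorSpline F μ n (q + 2) i s) ^ 2 := by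
  rw [← integral_sq_splineSum_eq H G, ← sum_extendCoeff (by omega) x (fun r _ => r ^ 2)
    fun _ => zero_pow two_ne_zero]
  refine H.sum_sq_le H' G hL (knot_eq_one hn (by omega)) (fun m hm hmK => ?_)
    (dif_neg (by omega))
  have hn' : (0 : ℝ) < n := by exact_mod_cast hn
  obtain ⟨k, rfl⟩ := Nat.exists_eq_add_of_le hm
  rw [show q + 3 + k + 1 = q + 2 + 1 + (k + 1) by omega, show q + 3 + k = q + 2 + 1 + k by omega,
    knot_add hn (by omega), knot_add hn (by omega)]
  gcongr
  simp

theorem wirtinger_interiorSpline (H : SplineFacts F μ (knot n (q + 2)) M L q)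
    (G : IsGrid F μ (knot n (q + 2)) (q + 2) (1 / n)) (hn : 0 < n)
    (x : Fin (n + (q + 2) - 2) → ℝ) :
    Real.pi ^ 2 * ∫ s in (0 : ℝ)..1, (∑ i, x i * interiorSpline F μ n (q + 2) i s) ^ 2 ≤
      ∫ s in (0 : ℝ)..1, (∑ i, x i * deriv (interiorSpline F μ n (q + 2) i) s) ^ 2 := by
  have hn' : (0 : ℝ) < n := by exact_mod_cast hn
  set c := extendCoeff n (q + 2) x
  -- The last index has coefficient `0`. Without it the range ends at an index whose knot is `(n -
  -- 1) / n < 1`, as the vanishing at `1` requires.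
  have hlast : splineSum F μ (knot n (q + 2)) q c (n + (q + 2) + 1)
      = splineSum F μ (knot n (q + 2)) q c (n + (q + 2)) := by
    funext s
    rw [splineSum, Finset.sum_range_succ, show c (n + (q + 2)) = 0 from dif_neg (by omega),
      zero_mul, add_zero, splineSum]
  have hder : ∀ i : Fin (n + (q + 2) - 2), ∀ s ∈ Set.Ioo (0 : ℝ) 1,
      HasDerivAt (interiorSpline F μ n (q + 2) i)
        (basisDeriv F μ (knot n (q + 2)) q (i + 2) s) s :=
    fun i s hs => H.hasDerivAt_succ G (i + 2) hs
  have hEq : ∫ s in (0 : ℝ)..1, (∑ i, x i * deriv (interiorSpline F μ n (q + 2) i) s) ^ 2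
      = ∫ s in (0 : ℝ)..1,
        (∑ i : Fin (n + (q + 2) - 2), x i * basisDeriv F μ (knot n (q + 2)) q (i + 2) s) ^ 2 := by
    rw [intervalIntegral.integral_of_le zero_le_one, intervalIntegral.integral_of_le zero_le_one,
      MeasureTheory.integral_Ioc_eq_integral_Ioo, MeasureTheory.integral_Ioc_eq_integral_Ioo]
    refine MeasureTheory.setIntegral_congr_fun measurableSet_Ioo fun s hs => ?_
    simp only [fun i => (hder i s hs).deriv]
  rw [hEq, ← integral_sq_splineSum_eq H G, hlast]
  refine wirtinger (B := ∑ i : Fin (n + (q + 2) - 2), |x i| *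
    (M / mass F μ (knot n (q + 2)) q (i + 2) + M / mass F μ (knot n (q + 2)) q (i + 2 + 1)))
    (H.continuous_splineSum _ _) ?_ ?_ ?_ ?_ ?_
  -- The coefficients start at index `2`, and the knot `t (2 + q + 2)` is the first interior one, `1
  -- / n`.
  · refine SplineFacts.splineSum_zero G (a := 2) (fun j hj => dif_neg (by omega)) ?_
    rw [show 2 + q + 2 = q + 2 + 1 + 1 by omega, knot_add hn hn]
    positivity
  · refine H.splineSum_one G ?_
    obtain ⟨k, rfl⟩ := Nat.exists_eq_add_of_le' hn
    rw [show k + 1 + (q + 2) = q + 2 + 1 + k by omega, knot_add hn (by omega), div_lt_one hn']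
    push_cast
    linarith
  · exact continuousOn_finsetSum _ fun i _ => continuousOn_const.mul
      (H.continuousOn_basisDeriv (i + 2))
  · intro s hs
    refine (Finset.abs_sum_le_sum_abs _ _).trans (Finset.sum_le_sum fun i _ => ?_)
    rw [abs_mul]
    exact mul_le_mul_of_nonneg_left (H.abs_basisDeriv_le (i + 2) hs) (abs_nonneg _)
  · intro s hs
    refine HasDerivAt.congr_of_eventuallyEq
      (HasDerivAt.fun_sum fun i _ => (hder i s hs).const_mul (x i)) ?_
    refine Filter.eventuallyEq_of_mem (isOpen_Ioo.mem_nhds hs) fun y hy => ?_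
    rw [← hlast]
    exact splineSum_extendCoeff_eq H G x hy

theorem dotProduct_massMatrix_mulVec (H' : SplineFacts F μ (knot n (q + 2)) M L (q + 1))
    (x : Fin (n + (q + 2) - 2) → ℝ) :
    dotProduct x ((massMatrix F μ n (q + 2)).mulVec x)
      = n * ∫ s in (0 : ℝ)..1, (∑ i, x i * interiorSpline F μ n (q + 2) i s) ^ 2 :=
  dotProduct_gram_mulVec (B := fun _ => M) (fun i => H'.continuousOn (i + 2))
    (fun i s hs => by
      rw [abs_of_nonneg (H'.nonneg (i + 2) s hs)]
      exact H'.le (i + 2) s hs) _ x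

theorem dotProduct_stiffnessMatrix_mulVec (H : SplineFacts F μ (knot n (q + 2)) M L q)
    (G : IsGrid F μ (knot n (q + 2)) (q + 2) (1 / n)) (x : Fin (n + (q + 2) - 2) → ℝ) :
    dotProduct x ((stiffnessMatrix F μ n (q + 2)).mulVec x)
      = 1 / n * ∫ s in (0 : ℝ)..1,
        (∑ i, x i * deriv (interiorSpline F μ n (q + 2) i) s) ^ 2 := by
  have hder : ∀ i : Fin (n + (q + 2) - 2), ∀ s ∈ Set.Ioo (0 : ℝ) 1,
      deriv (interiorSpline F μ n (q + 2) i) s = basisDeriv F μ (knot n (q + 2)) q (i + 2) s :=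
    fun i s hs => (H.hasDerivAt_succ G (i + 2) hs).deriv
  exact dotProduct_gram_mulVec (B := fun i : Fin (n + (q + 2) - 2) =>
      M / mass F μ (knot n (q + 2)) q (i + 2) + M / mass F μ (knot n (q + 2)) q (i + 2 + 1))
    (fun i => (H.continuousOn_basisDeriv (i + 2)).congr (hder i))
    (fun i s hs => by
      rw [hder i s hs]
      exact H.abs_basisDeriv_le (i + 2) hs) _ x

end Main

end GBSpline

end

/-! ### Assembly of the stability constant and the matrix bounds. -/

theorem mainTheorem3 (F : GBSpline.Family) (R : GBSpline.Regime) (α : ℝ) (hα : 0 < α)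
    (p : ℕ) (hp : 2 ≤ p) :
    (∃ C : ℝ, 0 < C ∧ GBSpline.IsStabilityConstant F R α p C) ∧
    ∀ C : ℝ, GBSpline.IsStabilityConstant F R α p C →
      ∀ n : ℕ, 2 ≤ n → F.Admissible (R.param α n) n →
        C ≤ GBSpline.lambdaMin (GBSpline.massMatrix_isHermitian F (R.param α n) n p) ∧
        (Real.pi ^ 2 / (n : ℝ) ^ 2) • GBSpline.massMatrix F (R.param α n) n p ≤
          GBSpline.stiffnessMatrix F (R.param α n) n p ∧
        Real.pi ^ 2 * C / (n : ℝ) ^ 2 ≤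
          GBSpline.lambdaMin (GBSpline.stiffnessMatrix_isHermitian F (R.param α n) n p) := by
  obtain ⟨q, rfl⟩ := Nat.exists_eq_add_of_le' hp
  obtain ⟨M, hM, hbound⟩ := GBSpline.exists_uniform_bound F R hα
  have facts : ∀ n : ℕ, 0 < n → F.Admissible (R.param α n) n → ∀ r, r + 1 ≤ q + 2 →
      GBSpline.SplineFacts F (R.param α n) (GBSpline.knot n (q + 2)) M (α ^ 2) r :=
    fun n hn hadm r hr => (GBSpline.isGrid_knot (q + 2) hn hadm).splineFacts hM
      (hbound n hn hadm).1 (hbound n hn hadm).2 hr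
  refine ⟨?_, fun C hC n hn hadm => ?_⟩
  · set D : ℝ := (q + 4) * (GBSpline.stabConst M (α ^ 2) (q + 1) ^ 2
      * GBSpline.markovConst (α ^ 2) (q + 2)) with hD
    have hD0 : 0 < D := by
      have h1 := GBSpline.stabConst_pos (zero_le_one.trans hM) (sq_nonneg α) (q + 1)
      have h2 := GBSpline.markovConst_pos (sq_nonneg α) (q + 2)
      positivity
    refine ⟨1 / D, by positivity, by positivity, fun n hn hadm x => ?_⟩
    have hn0 : 0 < n := by omega
    have := GBSpline.sum_sq_le_integral (facts n hn0 hadm q (by omega))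
      (facts n hn0 hadm (q + 1) le_rfl) (GBSpline.isGrid_knot (q + 2) hn0 hadm)
      (hbound n hn0 hadm).2 hn0 x
    rw [← hD] at this
    rw [show 1 / D * (∑ i, x i ^ 2) / n = (∑ i, x i ^ 2) * (1 / n) / D by ring,
      div_le_iff₀ hD0, mul_comm _ D]
    exact this
  · have hn0 : 0 < n := by omega
    have hn' : (0 : ℝ) < n := by exact_mod_cast hn0
    have G := GBSpline.isGrid_knot (q + 2) hn0 hadm
    have H := facts n hn0 hadm q (by omega)
    have H' := facts n hn0 hadm (q + 1) le_rfl
    have hm : 0 < n + (q + 2) - 2 := by omega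
    have hmass : ∀ x, C * ∑ i, x i ^ 2 ≤
        dotProduct x ((GBSpline.massMatrix F (R.param α n) n (q + 2)).mulVec x) := by
      intro x
      have := hC.2 n hn hadm x
      rw [div_le_iff₀ hn'] at this
      rw [GBSpline.dotProduct_massMatrix_mulVec H', mul_comm (n : ℝ)]
      exact this
    have hstiff : ∀ x, Real.pi ^ 2 / (n : ℝ) ^ 2 *
        dotProduct x ((GBSpline.massMatrix F (R.param α n) n (q + 2)).mulVec x) ≤
        dotProduct x ((GBSpline.stiffnessMatrix F (R.param α n) n (q + 2)).mulVec x) := by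
      intro x
      rw [GBSpline.dotProduct_massMatrix_mulVec H', GBSpline.dotProduct_stiffnessMatrix_mulVec H G]
      have := mul_le_mul_of_nonneg_left (GBSpline.wirtinger_interiorSpline H G hn0 x)
        (show 0 ≤ 1 / (n : ℝ) by positivity)
      refine le_of_eq_of_le ?_ this
      field_simp
    refine ⟨GBSpline.le_lambdaMin hm _ hmass, ?_, GBSpline.le_lambdaMin hm _ fun x => ?_⟩
    · rw [Matrix.le_iff]
      refine Matrix.PosSemidef.of_dotProduct_mulVec_nonneg ?_ fun x => ?_
      · refine (GBSpline.stiffnessMatrix_isHermitian F (R.param α n) n (q + 2)).sub ?_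
        rw [Matrix.IsHermitian, Matrix.conjTranspose_smul, star_trivial,
          (GBSpline.massMatrix_isHermitian F (R.param α n) n (q + 2)).eq]
      · rw [star_trivial, Matrix.sub_mulVec, dotProduct_sub, Matrix.smul_mulVec, dotProduct_smul,
          smul_eq_mul, sub_nonneg]
        exact hstiff x
    · refine le_trans ?_ (hstiff x)
      rw [mul_div_right_comm, mul_assoc]
      exact mul_le_mul_of_nonneg_left (hmass x) (by positivity)
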